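/- Let $k$ be a field, $G$ a finite set of letters with degrees $\deg x\ge 1$ $(x\in G)$, $F$ a finite set of words in $G$, and let $A=k\langle G\rangle/(F)$ be the resulting connected monomial algebra, with the induced $\mathbb N$-grading. A word is *legal* if it does not lie in the ideal $(F)$, and $L_n$ denotes the set of legal words of length (number of letters) $n$. Let $\ell+1$ be the maximal length of a word in $F$, with $\ell=0$ if $F=\varnothing$. The *weighted Ufnarovskii graph* $Q=Q(A)$ is the quiver with vertex set $L_\ell$ and arrow set $L_{\ell+1}$, in which $w\in L_{\ell+1}$, written $w=uy=xv$ with $x,y\in G$ and $u,v\in L_\ell$, is an arrow from $u$ to $v$ with label $x$ and degree $\deg x$. Let $kQ$ be its path algebra, graded by these degrees, in which $pq$ is the path $p$ followed by the path $q$ (and $pq=0$ if they cannot be concatenated). There is a homomorphism of graded algebras $f:A\to kQ$ that sends each $x\in G$ to the sum of all arrows with label $x$, and it makes $kQ$ a left $A$-module. For an $\mathbb N$-graded $k$-algebra $R$ let $\operatorname{Gr}R$ be the category of $\mathbb Z$-graded right $R$-modules and degree-preserving homomorphisms, let $\operatorname{Fdim}R$ be the full subcategory of the modules that are the sum of their finite-dimensional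 submodules, let $\operatorname{QGr}R=\operatorname{Gr}R/\operatorname{Fdim}R$ be the quotient category, that is, the localization of $\operatorname{Gr}R$ at the morphisms whose kernel and cokernel are in $\operatorname{Fdim}R$, and let $\pi^*:\operatorname{Gr}R\to\operatorname{QGr}R$ be the quotient functor. The shift $M\mapsto M(1)$, $M(1)_i=M_{i+1}$, of $\operatorname{Gr}R$ induces a shift functor on $\operatorname{QGr}R$, also denoted $(1)$. **Theorem.** The functor $-\otimes_A kQ:\operatorname{Gr}A\to\operatorname{Gr}kQ$ induces an equivalence of categories $\Phi:\operatorname{QGr}A\to\operatorname{QGr}kQ$, that is, there is an equivalence $\Phi$ with $\Phi\circ\pi^*\cong\pi^*\circ(-\otimes_A kQ)$. Moreover, $\Phi(M(1))\cong\Phi(M)(1)$ naturally in $M\in\operatorname{QGr}A$. -/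

import Mathlib

open CategoryTheory

universe u

noncomputable section

open MulOpposite

open scoped TensorProduct

/-! ### Graded right modules -/

section GradedModules

variable {k : Type u} [Field k]

/-- A `ℤ`-graded right module over a `k`-algebra `A` with an `ℕ`-grading `𝒜`.
Right `A`-modules are modules over `Aᵐᵒᵖ`, so that `m a` is `op a • m`. -/
structure GrMod {A : Type u} [Ring A] [Algebra k A] (𝒜 : ℕ → Submodule k A) : Type (u + 1) where
  carrier : Type u
  [addCommGroup : AddCommGroup carrier]
  [moduleBase : Module k carrier]
  [module : Module Aᵐᵒᵖ carrier]
  [isScalarTower : IsScalarTower k Aᵐᵒᵖ carrier]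
  /-- the homogeneous components -/
  deg : ℤ → Submodule k carrier
  isInternal : DirectSum.IsInternal deg
  smul_mem : ∀ {n : ℕ} {i : ℤ} {a : A} {m : carrier},
    a ∈ 𝒜 n → m ∈ deg i → op a • m ∈ deg (i + n)

namespace GrMod

attribute [instance] addCommGroup moduleBase module isScalarTower

variable {A : Type u} [Ring A] [Algebra k A] {𝒜 : ℕ → Submodule k A}

/-- Degree preserving homomorphisms of graded right modules. -/
@[ext]
structure Hom (M N : GrMod 𝒜) where
  toLinearMap : M.carrier →ₗ[Aᵐᵒᵖ] N.carrier
  map_mem : ∀ {i : ℤ} {m : M.carrier}, m ∈ M.deg i → toLinearMap m ∈ N.deg i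

/-- The category `Gr A`. -/
instance : Category (GrMod 𝒜) where
  Hom M N := Hom M N
  id M := ⟨LinearMap.id, fun h => h⟩
  comp f g := ⟨g.toLinearMap ∘ₗ f.toLinearMap, fun h => g.map_mem (f.map_mem h)⟩

@[ext]
theorem hom_ext {M N : GrMod 𝒜} {f g : M ⟶ N}
    (h : Hom.toLinearMap f = Hom.toLinearMap g) : f = g :=
  Hom.ext h

@[simp]
theorem id_toLinearMap (M : GrMod 𝒜) : Hom.toLinearMap (𝟙 M) = LinearMap.id := rfl

@[simp]
theorem comp_toLinearMap {M N P : GrMod 𝒜} (f : M ⟶ N) (g : N ⟶ P) :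
    Hom.toLinearMap (f ≫ g) = Hom.toLinearMap g ∘ₗ Hom.toLinearMap f := rfl

/-- A grading can be reindexed along a bijection. -/
theorem isInternal_reindex {V : Type u} [AddCommGroup V] [Module k V] {𝒱 : ℤ → Submodule k V}
    (h : DirectSum.IsInternal 𝒱) (e : ℤ ≃ ℤ) : DirectSum.IsInternal fun i => 𝒱 (e i) := by
  rw [DirectSum.isInternal_submodule_iff_iSupIndep_and_iSup_eq_top] at h ⊢
  refine ⟨h.1.comp e.injective, ?_⟩
  rw [← h.2]
  exact e.iSup_comp (g := 𝒱)

/-- The shift `M(1)`: the same module with `M(1)_i = M_{i+1}`. -/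
def shiftObj (M : GrMod 𝒜) : GrMod 𝒜 where
  carrier := M.carrier
  deg i := M.deg (i + 1)
  isInternal := isInternal_reindex M.isInternal (Equiv.addRight 1)
  smul_mem {n i a m} ha hm := by
    have := M.smul_mem ha hm
    rwa [add_right_comm] at this

variable (𝒜) in
/-- The shift functor `(1) : Gr A ⥤ Gr A`. -/
def shift : GrMod 𝒜 ⥤ GrMod 𝒜 where
  obj := shiftObj
  map {M N} f := (⟨(f : Hom M N).toLinearMap, fun h => Hom.map_mem f h⟩ :
    Hom M.shiftObj N.shiftObj)

end GrMod

/-- A right module is in `Fdim` if it is the sum of its finite-dimensional submodules. For a graded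
module it makes no difference whether only graded submodules are used, because the submodule
generated by a homogeneous element is graded. -/
def IsFdim (k A M : Type u) [Field k] [Ring A] [Algebra k A]
    [AddCommGroup M] [Module k M] [Module Aᵐᵒᵖ M] [IsScalarTower k Aᵐᵒᵖ M] : Prop :=
  sSup {N : Submodule Aᵐᵒᵖ M | FiniteDimensional k N} = ⊤

variable {A : Type u} [Ring A] [Algebra k A]

/-- The morphisms of `Gr A` whose kernel and cokernel are in `Fdim A`. -/
def fdimIso (𝒜 : ℕ → Submodule k A) : MorphismProperty (GrMod 𝒜) := fun _ N f =>
  IsFdim k A (LinearMap.ker (GrMod.Hom.toLinearMap f)) ∧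
    IsFdim k A (N.carrier ⧸ LinearMap.range (GrMod.Hom.toLinearMap f))

/-- The quotient category `QGr A` of `Gr A` by the localizing subcategory `Fdim A`: the
localization of `Gr A` at the morphisms with kernel and cokernel in `Fdim A`. -/
abbrev QGr (𝒜 : ℕ → Submodule k A) := (fdimIso 𝒜).Localization

namespace QGr

/-- The quotient functor `π^* : Gr A ⥤ QGr A`. -/
abbrev proj (𝒜 : ℕ → Submodule k A) : GrMod 𝒜 ⥤ QGr 𝒜 := (fdimIso 𝒜).Q

/-- The shift functor sends morphisms with kernel and cokernel in `Fdim A` to such morphisms. -/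
theorem shift_isInvertedBy (𝒜 : ℕ → Submodule k A) :
    (fdimIso 𝒜).IsInvertedBy (GrMod.shift 𝒜 ⋙ proj 𝒜) := fun _ _ f hf =>
  (fdimIso 𝒜).Q_inverts ((GrMod.shift 𝒜).map f) (show fdimIso 𝒜 f from hf)

/-- The shift functor of `QGr A`, induced by that of `Gr A`. -/
def shift (𝒜 : ℕ → Submodule k A) : QGr 𝒜 ⥤ QGr 𝒜 :=
  Localization.Construction.lift (GrMod.shift 𝒜 ⋙ proj 𝒜) (shift_isInvertedBy 𝒜)

end QGr

/-! ### The functor `- ⊗_A B` -/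

/-- The relations `m a ⊗ b = m ⊗ f(a) b`. The tensor product is written with its factors
exchanged: `b ⊗ₜ m` stands for `m ⊗ b`, and the right action of `B` is on the factor `b`. -/
def tensorRel {B : Type u} [Ring B] [Algebra k B] (f : A →ₐ[k] B)
    (M : Type u) [AddCommGroup M] [Module k M] [Module Aᵐᵒᵖ M] : Submodule Bᵐᵒᵖ (B ⊗[k] M) :=
  Submodule.span Bᵐᵒᵖ
    {t | ∃ (m : M) (a : A) (b : B), t = b ⊗ₜ[k] (op a • m) - (f a * b) ⊗ₜ[k] m}

/-- The right `B`-module `M ⊗_A B`, where `A` acts on `B` from the left through `f`. -/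
abbrev TensorMod {B : Type u} [Ring B] [Algebra k B] (f : A →ₐ[k] B)
    (M : Type u) [AddCommGroup M] [Module k M] [Module Aᵐᵒᵖ M] : Type u :=
  (B ⊗[k] M) ⧸ tensorRel f M



/-- The homogeneous components of `M ⊗_A B`: the component of degree `n` is spanned by the
elements `m ⊗ b` with `m` and `b` homogeneous of degrees with sum `n`. -/
def tensorDeg {B : Type u} [Ring B] [Algebra k B] {𝒜 : ℕ → Submodule k A}
    (ℬ : ℕ → Submodule k B) (f : A →ₐ[k] B) (M : GrMod 𝒜) (n : ℤ) :
    Submodule k (TensorMod f M.carrier) :=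
  Submodule.span k {t | ∃ (i : ℤ) (j : ℕ) (m : M.carrier) (b : B),
    i + j = n ∧ m ∈ M.deg i ∧ b ∈ ℬ j ∧ t = Submodule.Quotient.mk (b ⊗ₜ[k] m)}

section TensorGrading

theorem exists_components {ι : Type} {V : Type u} [DecidableEq ι] [AddCommGroup V] [Module k V]
    {𝒱 : ι → Submodule k V} (h : DirectSum.IsInternal 𝒱) :
    ∃ ρ : V →ₗ[k] (ι →₀ V), ∀ (i : ι) (v : V), v ∈ 𝒱 i → ρ v = Finsupp.single i v := by
  let e := LinearEquiv.ofBijective (DirectSum.coeLinearMap 𝒱) h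
  refine ⟨DirectSum.toModule k ι (ι →₀ V) (fun i => Finsupp.lsingle i ∘ₗ (𝒱 i).subtype) ∘ₗ
    e.symm.toLinearMap, fun i v hv => ?_⟩
  have : e.symm v = DirectSum.lof k ι (fun i => 𝒱 i) i ⟨v, hv⟩ := by
    rw [LinearEquiv.symm_apply_eq]
    exact (DirectSum.coeLinearMap_lof 𝒱 i ⟨v, hv⟩).symm
  simp [this]

theorem isInternal_of_components {V : Type u} [AddCommGroup V] [Module k V]
    {𝒱 : ℤ → Submodule k V} (ρ : V →ₗ[k] (ℤ →₀ V))
    (h : ∀ (i : ℤ) (v : V), v ∈ 𝒱 i → ρ v = Finsupp.single i v) (htop : ⨆ i, 𝒱 i = ⊤) :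
    DirectSum.IsInternal 𝒱 := by
  refine ⟨?_, ?_⟩
  · change Function.Injective (DirectSum.coeLinearMap 𝒱)
    rw [← LinearMap.ker_eq_bot, LinearMap.ker_eq_bot']
    intro x hx
    have key : ∀ y : DirectSum ℤ (fun i => 𝒱 i), ∀ i,
        ρ (DirectSum.coeLinearMap 𝒱 y) i = (y i : V) := by
      intro y i
      induction y using DirectSum.induction_on with
      | zero => simp
      | of j v =>
        rw [← DirectSum.lof_eq_of k, DirectSum.coeLinearMap_lof, h j v v.2]
        by_cases hij : j = i
        · subst hij
          simp [DirectSum.lof_eq_of]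
        · rw [Finsupp.single_eq_of_ne (Ne.symm hij), DirectSum.lof_eq_of,
            DirectSum.of_eq_of_ne _ _ _ (Ne.symm hij)]
          rfl
      | add y z hy hz => simp [hy, hz]
    ext i
    rw [← key, hx]
    simp
  · change Function.Surjective (DirectSum.coeLinearMap 𝒱)
    rw [← LinearMap.range_eq_top, ← htop]
    exact (Submodule.iSup_eq_range_dfinsupp_lsum 𝒱).symm

variable {B : Type u} [Ring B] [Algebra k B] {𝒜 : ℕ → Submodule k A}
  {ℬ : ℕ → Submodule k B} (f : A →ₐ[k] B)

/-- The relations are spanned over `k` by the generators. -/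
theorem tensorRel_eq_span (M : Type u) [AddCommGroup M] [Module k M] [Module Aᵐᵒᵖ M] :
    ∀ t ∈ tensorRel f M, t ∈ Submodule.span k
      {t | ∃ (m : M) (a : A) (b : B), t = b ⊗ₜ[k] (op a • m) - (f a * b) ⊗ₜ[k] m} := by
  intro t ht
  induction ht using Submodule.span_induction with
  | mem t ht => exact Submodule.subset_span ht
  | zero => exact zero_mem _
  | add x y _ _ hx hy => exact add_mem hx hy
  | smul r x hx' hx =>
    clear hx'
    induction hx using Submodule.span_induction with
    | mem t ht =>
      obtain ⟨m, a, b, rfl⟩ := ht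
      refine Submodule.subset_span ⟨m, a, r • b, ?_⟩
      rw [smul_sub, TensorProduct.smul_tmul', TensorProduct.smul_tmul']
      congr 2
      simp [mul_assoc]
    | zero => simp
    | add x y _ _ hx hy => rw [smul_add]; exact add_mem hx hy
    | smul c x _ hx => rw [smul_comm]; exact Submodule.smul_mem _ c hx

theorem exists_tensor_components [GradedAlgebra 𝒜] [GradedAlgebra ℬ]
    (hf : ∀ (n : ℕ) (a : A), a ∈ 𝒜 n → f a ∈ ℬ n) (M : GrMod 𝒜) :
    ∃ ρ : TensorMod f M.carrier →ₗ[k] (ℤ →₀ TensorMod f M.carrier),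
      ∀ (i : ℤ) (j : ℕ) (m : M.carrier) (b : B), m ∈ M.deg i → b ∈ ℬ j →
        ρ (Submodule.Quotient.mk (b ⊗ₜ[k] m)) =
          Finsupp.single (i + j) (Submodule.Quotient.mk (b ⊗ₜ[k] m)) := by
  obtain ⟨ρM, hM⟩ := exists_components M.isInternal
  obtain ⟨ρB, hB⟩ := exists_components (DirectSum.Decomposition.isInternal ℬ)
  let π : (B ⊗[k] M.carrier) →ₗ[k] TensorMod f M.carrier :=
    (tensorRel f M.carrier).mkQ.restrictScalars k
  let β : (ℕ →₀ B) →ₗ[k] (ℤ →₀ M.carrier) →ₗ[k] (ℤ →₀ TensorMod f M.carrier) :=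
    Finsupp.lsum k fun j => LinearMap.flip <| Finsupp.lsum k fun i => LinearMap.flip <|
      (TensorProduct.mk k B M.carrier).compr₂ (Finsupp.lsingle (i + (j : ℤ)) ∘ₗ π)
  have hβ : ∀ (i : ℤ) (j : ℕ) (m : M.carrier) (b : B), m ∈ M.deg i → b ∈ ℬ j →
      β (ρB b) (ρM m) = Finsupp.single (i + (j : ℤ)) (π (b ⊗ₜ[k] m)) := by
    intro i j m b hm hb
    rw [hB j b hb, hM i m hm]
    simp [β]
  let γ : (B ⊗[k] M.carrier) →ₗ[k] (ℤ →₀ TensorMod f M.carrier) :=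
    TensorProduct.lift (β.compl₁₂ ρB ρM)
  have hγ : ∀ (i : ℤ) (j : ℕ) (m : M.carrier) (b : B), m ∈ M.deg i → b ∈ ℬ j →
      γ (b ⊗ₜ[k] m) = Finsupp.single (i + (j : ℤ)) (π (b ⊗ₜ[k] m)) := by
    intro i j m b hm hb
    simpa [γ] using hβ i j m b hm hb
  have hker : ∀ (m : M.carrier) (a : A) (b : B),
      γ (b ⊗ₜ[k] (op a • m) - (f a * b) ⊗ₜ[k] m) = 0 := by
    intro m a b
    have hm : m ∈ ⨆ i, M.deg i := by
      rw [(DirectSum.isInternal_submodule_iff_iSupIndep_and_iSup_eq_top _).1 M.isInternal |>.2]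
      trivial
    have ha : a ∈ ⨆ i, 𝒜 i := by
      rw [(DirectSum.isInternal_submodule_iff_iSupIndep_and_iSup_eq_top _).1
        (DirectSum.Decomposition.isInternal 𝒜) |>.2]
      trivial
    have hb : b ∈ ⨆ i, ℬ i := by
      rw [(DirectSum.isInternal_submodule_iff_iSupIndep_and_iSup_eq_top _).1
        (DirectSum.Decomposition.isInternal ℬ) |>.2]
      trivial
    rw [map_sub, sub_eq_zero]
    induction hm using Submodule.iSup_induction' with
    | zero => simp
    | add x y _ _ hx hy => simp only [smul_add, TensorProduct.tmul_add, map_add, hx, hy]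
    | mem i m hm =>
    induction ha using Submodule.iSup_induction' with
    | zero => simp
    | add x y _ _ hx hy =>
      rw [MulOpposite.op_add, add_smul, TensorProduct.tmul_add, map_add, hx, hy, map_add, add_mul,
        TensorProduct.add_tmul, map_add]
    | mem n a ha =>
    induction hb using Submodule.iSup_induction' with
    | zero => simp
    | add x y _ _ hx hy => simp only [mul_add, TensorProduct.add_tmul, map_add, hx, hy]
    | mem j b hb =>
    rw [hγ (i + n) j _ b (M.smul_mem ha hm) hb,
      hγ i (n + j) m _ hm (SetLike.mul_mem_graded (hf n a ha) hb)]
    have : π (b ⊗ₜ[k] (op a • m)) = π ((f a * b) ⊗ₜ[k] m) :=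
      (Submodule.Quotient.eq _).2 (Submodule.subset_span ⟨m, a, b, rfl⟩)
    rw [this]
    push_cast
    rw [add_assoc]
  have hle : (tensorRel f M.carrier).restrictScalars k ≤ LinearMap.ker γ := by
    intro t ht
    have := tensorRel_eq_span f M.carrier t ht
    refine (Submodule.span_le (p := LinearMap.ker γ)).2 ?_ this
    rintro _ ⟨m, a, b, rfl⟩
    exact hker m a b
  exact ⟨((tensorRel f M.carrier).restrictScalars k).liftQ γ hle,
    fun i j m b hm hb => hγ i j m b hm hb⟩

theorem tensorDeg_isInternal [GradedAlgebra 𝒜] [GradedAlgebra ℬ]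
    (hf : ∀ (n : ℕ) (a : A), a ∈ 𝒜 n → f a ∈ ℬ n) (M : GrMod 𝒜) :
    DirectSum.IsInternal (tensorDeg ℬ f M) := by
  obtain ⟨ρ, hρ⟩ := exists_tensor_components f hf M
  refine isInternal_of_components ρ ?_ ?_
  · intro n v hv
    induction hv using Submodule.span_induction with
    | mem v hv =>
      obtain ⟨i, j, m, b, rfl, hm, hb, rfl⟩ := hv
      exact hρ i j m b hm hb
    | zero => simp
    | add x y _ _ hx hy => simp [hx, hy]
    | smul c x _ hx => simp [hx]
  · rw [eq_top_iff]
    rintro t -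
    obtain ⟨t, rfl⟩ := Submodule.Quotient.mk_surjective _ t
    induction t using TensorProduct.induction_on with
    | zero => rw [Submodule.Quotient.mk_zero]; exact zero_mem _
    | add x y hx hy => rw [Submodule.Quotient.mk_add]; exact add_mem hx hy
    | tmul b m =>
    have hm : m ∈ ⨆ i, M.deg i := by
      rw [(DirectSum.isInternal_submodule_iff_iSupIndep_and_iSup_eq_top _).1 M.isInternal |>.2]
      trivial
    have hb : b ∈ ⨆ i, ℬ i := by
      rw [(DirectSum.isInternal_submodule_iff_iSupIndep_and_iSup_eq_top _).1
        (DirectSum.Decomposition.isInternal ℬ) |>.2]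
      trivial
    induction hm using Submodule.iSup_induction' with
    | zero => rw [TensorProduct.tmul_zero, Submodule.Quotient.mk_zero]; exact zero_mem _
    | add x y _ _ hx hy =>
      rw [TensorProduct.tmul_add, Submodule.Quotient.mk_add]; exact add_mem hx hy
    | mem i m hm =>
    induction hb using Submodule.iSup_induction' with
    | zero => rw [TensorProduct.zero_tmul, Submodule.Quotient.mk_zero]; exact zero_mem _
    | add x y _ _ hx hy =>
      rw [TensorProduct.add_tmul, Submodule.Quotient.mk_add]; exact add_mem hx hy
    | mem j b hb =>
    exact Submodule.mem_iSup_of_mem (i + j) (Submodule.subset_span ⟨i, j, m, b, rfl, hm, hb, rfl⟩)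

end TensorGrading

/-- The graded right `B`-module `M ⊗_A B`. -/
def tensorObj {B : Type u} [Ring B] [Algebra k B] {𝒜 : ℕ → Submodule k A}
    {ℬ : ℕ → Submodule k B} [GradedAlgebra 𝒜] [GradedAlgebra ℬ] (f : A →ₐ[k] B)
    (hf : ∀ (n : ℕ) (a : A), a ∈ 𝒜 n → f a ∈ ℬ n) (M : GrMod 𝒜) : GrMod ℬ where
  carrier := TensorMod f M.carrier
  deg := tensorDeg ℬ f M
  isInternal := tensorDeg_isInternal f hf M
  smul_mem {n i c t} hc ht := by
    induction ht using Submodule.span_induction with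
    | mem t ht =>
      obtain ⟨i, j, m, b, rfl, hm, hb, rfl⟩ := ht
      refine Submodule.subset_span ⟨i, j + n, m, b * c, by push_cast; rw [add_assoc], hm,
        SetLike.mul_mem_graded hb hc, ?_⟩
      rw [← Submodule.Quotient.mk_smul, TensorProduct.smul_tmul', op_smul_eq_mul]
    | zero => simp
    | add x y _ _ hx hy => rw [smul_add]; exact add_mem hx hy
    | smul r x _ hx => rw [smul_comm]; exact Submodule.smul_mem _ r hx

/-- The homomorphism `g ⊗_A B`. -/
def tensorMap {B : Type u} [Ring B] [Algebra k B] (f : A →ₐ[k] B) {𝒜 : ℕ → Submodule k A}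
    {M N : GrMod 𝒜} (g : M ⟶ N) :
    TensorMod f M.carrier →ₗ[Bᵐᵒᵖ] TensorMod f N.carrier :=
  (tensorRel f M.carrier).mapQ (tensorRel f N.carrier)
    (TensorProduct.AlgebraTensorModule.map (LinearMap.id : B →ₗ[Bᵐᵒᵖ] B)
      ((GrMod.Hom.toLinearMap g).restrictScalars k)) <| by
    rw [tensorRel, Submodule.span_le]
    rintro _ ⟨m, a, b, rfl⟩
    exact Submodule.subset_span ⟨GrMod.Hom.toLinearMap g m, a, b, by simp⟩

theorem tensorMap_mk {B : Type u} [Ring B] [Algebra k B] (f : A →ₐ[k] B)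
    {𝒜 : ℕ → Submodule k A} {M N : GrMod 𝒜} (g : M ⟶ N) (b : B) (m : M.carrier) :
    tensorMap f g (Submodule.Quotient.mk (b ⊗ₜ[k] m)) =
      Submodule.Quotient.mk (b ⊗ₜ[k] GrMod.Hom.toLinearMap g m) := rfl


theorem tensorMap_mem {B : Type u} [Ring B] [Algebra k B] {𝒜 : ℕ → Submodule k A}
    (ℬ : ℕ → Submodule k B) (f : A →ₐ[k] B) {M N : GrMod 𝒜} (g : M ⟶ N) (n : ℤ)
    (t : TensorMod f M.carrier) (ht : t ∈ tensorDeg ℬ f M n) :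
    tensorMap f g t ∈ tensorDeg ℬ f N n := by
  induction ht using Submodule.span_induction with
  | mem t ht =>
    obtain ⟨i, j, m, b, rfl, hm, hb, rfl⟩ := ht
    exact Submodule.subset_span ⟨i, j, _, b, rfl, GrMod.Hom.map_mem g hm, hb, rfl⟩
  | zero => rw [map_zero]; exact zero_mem _
  | add x y _ _ hx hy => rw [map_add]; exact add_mem hx hy
  | smul r x _ hx => rw [LinearMap.map_smul_of_tower]; exact Submodule.smul_mem _ r hx

theorem tensorMap_id {B : Type u} [Ring B] [Algebra k B] {𝒜 : ℕ → Submodule k A}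
    (f : A →ₐ[k] B) (M : GrMod 𝒜) : tensorMap f (𝟙 M) = LinearMap.id := by
  apply LinearMap.ext
  intro t
  obtain ⟨t, rfl⟩ := Submodule.Quotient.mk_surjective _ t
  induction t using TensorProduct.induction_on with
  | zero => rw [Submodule.Quotient.mk_zero, map_zero, map_zero]
  | add x y hx hy => rw [Submodule.Quotient.mk_add, map_add, map_add, hx, hy]
  | tmul b m => rfl

theorem tensorMap_comp {B : Type u} [Ring B] [Algebra k B] {𝒜 : ℕ → Submodule k A}
    (f : A →ₐ[k] B) {M N P : GrMod 𝒜} (g : M ⟶ N) (h : N ⟶ P) :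
    tensorMap f (g ≫ h) = tensorMap f h ∘ₗ tensorMap f g := by
  apply LinearMap.ext
  intro t
  obtain ⟨t, rfl⟩ := Submodule.Quotient.mk_surjective _ t
  induction t using TensorProduct.induction_on with
  | zero => rw [Submodule.Quotient.mk_zero, map_zero, map_zero]
  | add x y hx hy => rw [Submodule.Quotient.mk_add, map_add, map_add, hx, hy]
  | tmul b m => rfl

/-- The functor `- ⊗_A B : Gr A ⥤ Gr B` for a homomorphism of graded algebras `f : A → B`. -/
def tensorFunctor {B : Type u} [Ring B] [Algebra k B] {𝒜 : ℕ → Submodule k A}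
    {ℬ : ℕ → Submodule k B} [GradedAlgebra 𝒜] [GradedAlgebra ℬ] (f : A →ₐ[k] B)
    (hf : ∀ (n : ℕ) (a : A), a ∈ 𝒜 n → f a ∈ ℬ n) : GrMod 𝒜 ⥤ GrMod ℬ where
  obj M := tensorObj f hf M
  map {M N} g := (⟨tensorMap f g, fun {n t} => tensorMap_mem ℬ f g n t⟩ :
    GrMod.Hom (tensorObj f hf M) (tensorObj f hf N))
  map_id M := GrMod.hom_ext (tensorMap_id f M)
  map_comp g h := GrMod.hom_ext (tensorMap_comp f g h)

end GradedModules
/-! ### Weighted path algebras -/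

section PathAlgebras

/-- The paths of a quiver (including the trivial paths), with their source and target. -/
abbrev TotalPath (V : Type u) [Quiver.{u} V] : Type u :=
  Σ (v w : V), Quiver.Path v w

/-- The path algebra `kQ`, with the paths of `Q` as basis. -/
def PathAlgebra (k V : Type u) [Field k] [Quiver.{u} V] : Type u :=
  TotalPath V →₀ k

namespace PathAlgebra

variable {k V : Type u} [Field k] [Quiver.{u} V]

instance : AddCommGroup (PathAlgebra k V) := inferInstanceAs (AddCommGroup (TotalPath V →₀ k))

instance : Module k (PathAlgebra k V) := inferInstanceAs (Module k (TotalPath V →₀ k))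

variable (k) in
/-- The basis element given by a path. -/
def ofPath (p : TotalPath V) : PathAlgebra k V := Finsupp.single p (1 : k)

open Classical in
variable (k) in
/-- The product `p q` of two paths: first `p`, then `q`, if `p` ends where `q` starts, and `0`
otherwise. -/
def pathMul : TotalPath V → TotalPath V → PathAlgebra k V
  | ⟨a, b, p⟩, ⟨c, d, q⟩ => if h : b = c then ofPath k ⟨a, d, p.comp (h ▸ q)⟩ else 0

theorem pathMul_comp {a b c : V} (p : Quiver.Path a b) (q : Quiver.Path b c) :
    pathMul k ⟨a, b, p⟩ ⟨b, c, q⟩ = ofPath k ⟨a, c, p.comp q⟩ := by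
  simp [pathMul]

theorem pathMul_of_ne {a b c d : V} (p : Quiver.Path a b) (q : Quiver.Path c d) (h : b ≠ c) :
    pathMul k ⟨a, b, p⟩ ⟨c, d, q⟩ = 0 := by
  simp [pathMul, h]

/-- A linear map is determined by its values on paths. -/
def lift {W : Type u} [AddCommGroup W] [Module k W] (φ : TotalPath V → W) :
    PathAlgebra k V →ₗ[k] W :=
  Finsupp.linearCombination k φ

theorem lift_ofPath {W : Type u} [AddCommGroup W] [Module k W] (φ : TotalPath V → W)
    (p : TotalPath V) : lift φ (ofPath k p) = φ p :=
  (Finsupp.linearCombination_single k (1 : k) p).trans (one_smul k (φ p))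

theorem linearMap_ext {W : Type u} [AddCommGroup W] [Module k W] {φ ψ : PathAlgebra k V →ₗ[k] W}
    (h : ∀ p, φ (ofPath k p) = ψ (ofPath k p)) : φ = ψ :=
  Finsupp.lhom_ext' fun p => LinearMap.ext_ring (h p)

theorem induction {P : PathAlgebra k V → Prop} (x : PathAlgebra k V) (zero : P 0)
    (add : ∀ x y, P x → P y → P (x + y)) (smul : ∀ (r : k) p, P (r • ofPath k p)) : P x := by
  refine Finsupp.induction_linear (motive := P) x zero add fun p r => ?_
  have : (Finsupp.single p r : TotalPath V →₀ k) = r • Finsupp.single p (1 : k) := by simp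
  rw [this]
  exact smul r p

variable (k V) in
/-- The multiplication as a bilinear map. -/
def mulLinear : PathAlgebra k V →ₗ[k] PathAlgebra k V →ₗ[k] PathAlgebra k V :=
  lift fun p => lift fun q => pathMul k p q

theorem mulLinear_ofPath (p q : TotalPath V) :
    mulLinear k V (ofPath k p) (ofPath k q) = pathMul k p q := by
  simp [mulLinear, lift_ofPath]

theorem pathMul_assoc (p q r : TotalPath V) :
    mulLinear k V (pathMul k p q) (ofPath k r) = mulLinear k V (ofPath k p) (pathMul k q r) := by
  obtain ⟨a, b, p⟩ := p
  obtain ⟨c, d, q⟩ := q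
  obtain ⟨e, f, r⟩ := r
  by_cases h : b = c
  · subst h
    by_cases h' : d = e
    · subst h'
      simp [pathMul_comp, mulLinear_ofPath]
    · simp [pathMul_comp, pathMul_of_ne _ _ h', mulLinear_ofPath]
  · by_cases h' : d = e
    · subst h'
      simp [pathMul_comp, pathMul_of_ne _ _ h, mulLinear_ofPath]
    · simp [pathMul_of_ne _ _ h, pathMul_of_ne _ _ h']

theorem mulLinear_assoc (x y z : PathAlgebra k V) :
    mulLinear k V (mulLinear k V x y) z = mulLinear k V x (mulLinear k V y z) := by
  induction x using PathAlgebra.induction with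
  | zero => simp
  | add x y hx hy => simp only [map_add, LinearMap.add_apply, hx, hy]
  | smul r p =>
  induction y using PathAlgebra.induction with
  | zero => simp
  | add x y hx hy => simp only [map_add, LinearMap.add_apply, hx, hy]
  | smul s q =>
  induction z using PathAlgebra.induction with
  | zero => simp
  | add x y hx hy => simp only [map_add, hx, hy]
  | smul t r =>
    simp only [map_smul, LinearMap.smul_apply, mulLinear_ofPath, pathMul_assoc]

variable [Fintype V]

variable (k V) in
/-- The identity is the sum of the trivial paths `e_v`. -/
def oneElt : PathAlgebra k V := ∑ v : V, ofPath k ⟨v, v, Quiver.Path.nil⟩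

theorem oneElt_mul (x : PathAlgebra k V) : mulLinear k V (oneElt k V) x = x := by
  suffices mulLinear k V (oneElt k V) = LinearMap.id from congrArg (fun φ => φ x) this
  refine linearMap_ext fun ⟨a, b, p⟩ => ?_
  rw [oneElt, map_sum, LinearMap.sum_apply, Finset.sum_eq_single a]
  · rw [mulLinear_ofPath, pathMul_comp, Quiver.Path.nil_comp, LinearMap.id_apply]
  · intro v _ hv
    rw [mulLinear_ofPath, pathMul_of_ne _ _ hv]
  · simp

theorem mul_oneElt (x : PathAlgebra k V) : mulLinear k V x (oneElt k V) = x := by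
  suffices (mulLinear k V).flip (oneElt k V) = LinearMap.id from congrArg (fun φ => φ x) this
  refine linearMap_ext fun ⟨a, b, p⟩ => ?_
  rw [LinearMap.flip_apply, oneElt, map_sum, Finset.sum_eq_single b]
  · rw [mulLinear_ofPath, pathMul_comp, Quiver.Path.comp_nil, LinearMap.id_apply]
  · intro v _ hv
    rw [mulLinear_ofPath, pathMul_of_ne _ _ hv.symm]
  · simp

instance : Ring (PathAlgebra k V) :=
  { (inferInstance : AddCommGroup (PathAlgebra k V)) with
    mul := fun x y => mulLinear k V x y
    one := oneElt k V
    mul_assoc := mulLinear_assoc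
    one_mul := oneElt_mul
    mul_one := mul_oneElt
    left_distrib := fun x y z => map_add (mulLinear k V x) y z
    right_distrib := fun x y z => LinearMap.map_add₂ (mulLinear k V) x y z
    zero_mul := fun x => LinearMap.map_zero₂ (mulLinear k V) x
    mul_zero := fun x => map_zero (mulLinear k V x) }

theorem mul_def (x y : PathAlgebra k V) : x * y = mulLinear k V x y := rfl

theorem one_def : (1 : PathAlgebra k V) = ∑ v : V, ofPath k ⟨v, v, Quiver.Path.nil⟩ := rfl

theorem ofPath_mul_ofPath (p q : TotalPath V) : ofPath k p * ofPath k q = pathMul k p q :=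
  mulLinear_ofPath p q

instance : Algebra k (PathAlgebra k V) :=
  Algebra.ofModule (fun r x y => LinearMap.map_smul₂ (mulLinear k V) r x y)
    (fun r x y => map_smul (mulLinear k V x) r y)

/-- The degree of a path: the sum of the degrees `wt` of its arrows. -/
def pathDegree (wt : ∀ v w : V, (v ⟶ w) → ℕ) (p : TotalPath V) : ℕ :=
  p.2.2.addWeight fun {v w} a => wt v w a

variable (k) in
/-- The grading of the weighted path algebra for arrow degrees `wt`: the component of degree `n`
is spanned by the paths of degree `n`. -/
def grading (wt : ∀ v w : V, (v ⟶ w) → ℕ) (n : ℕ) : Submodule k (PathAlgebra k V) :=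
  Submodule.span k {x | ∃ p : TotalPath V, pathDegree wt p = n ∧ x = ofPath k p}

instance (wt : ∀ v w : V, (v ⟶ w) → ℕ) : SetLike.GradedMonoid (grading k wt) where
  one_mem := by
    rw [one_def]
    exact sum_mem fun v _ => Submodule.subset_span 
      ⟨⟨v, v, Quiver.Path.nil⟩, Quiver.Path.addWeight_nil _ v, rfl⟩
  mul_mem i j x y hx hy := by
    induction hx using Submodule.span_induction with
    | zero => rw [zero_mul]; exact zero_mem _
    | add x y _ _ hx hy => rw [add_mul]; exact add_mem hx hy
    | smul r x _ hx => rw [smul_mul_assoc]; exact Submodule.smul_mem _ r hx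
    | mem x hx =>
    induction hy using Submodule.span_induction with
    | zero => rw [mul_zero]; exact zero_mem _
    | add x y _ _ hx hy => rw [mul_add]; exact add_mem hx hy
    | smul r x _ hx => rw [mul_smul_comm]; exact Submodule.smul_mem _ r hx
    | mem y hy =>
    obtain ⟨⟨a, b, p⟩, rfl, rfl⟩ := hx
    obtain ⟨⟨c, d, q⟩, rfl, rfl⟩ := hy
    rw [ofPath_mul_ofPath]
    by_cases h : b = c
    · subst h
      rw [pathMul_comp]
      exact Submodule.subset_span 
        ⟨⟨a, d, p.comp q⟩, Quiver.Path.addWeight_comp _ p q, rfl⟩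
    · rw [pathMul_of_ne _ _ h]
      exact zero_mem _

instance (wt : ∀ v w : V, (v ⟶ w) → ℕ) : GradedAlgebra (grading k wt) where
  toDecomposition := DirectSum.Decomposition.ofLinearMap (grading k wt)
    (lift fun p => DirectSum.lof k ℕ (fun n => grading k wt n) (pathDegree wt p)
        ⟨ofPath k p, Submodule.subset_span ⟨_, rfl, rfl⟩⟩)
    (linearMap_ext fun p => by
      rw [LinearMap.comp_apply, lift_ofPath, DirectSum.coeLinearMap_lof, LinearMap.id_apply])
    (by
      ext n ⟨x, hx⟩ : 2
      simp only [LinearMap.comp_apply, DirectSum.coeLinearMap_lof, LinearMap.id_apply]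
      induction hx using Submodule.span_induction with
      | zero => rw [map_zero]; exact (map_zero (DirectSum.lof k ℕ _ n)).symm
      | add x y hx' hy' hx hy =>
        rw [map_add, hx, hy, ← map_add]; rfl
      | smul r x hx' hx => rw [map_smul, hx, ← map_smul]; rfl
      | mem x hx =>
        obtain ⟨p, rfl, rfl⟩ := hx
        rw [lift_ofPath])

end PathAlgebra

end PathAlgebras
/-! ### Connected monomial algebras and their Ufnarovskii graphs -/

section MonomialAlgebras

variable {k : Type u} [Field k] {G : Type u}

variable (k) in
/-- A word as an element of the free algebra `k⟨G⟩`. -/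
def freeWord (w : List G) : FreeAlgebra k G := (w.map (FreeAlgebra.ι k)).prod

variable (k) in
/-- The relations `w = 0` for the forbidden words `w ∈ F`. -/
def MonomialRel (F : Finset (List G)) (a b : FreeAlgebra k G) : Prop :=
  ∃ w ∈ F, a = freeWord k w ∧ b = 0

variable (k) in
/-- The monomial algebra `A = k⟨G⟩/(F)`. -/
abbrev MonomialAlgebra (F : Finset (List G)) : Type u := RingQuot (MonomialRel k F)

namespace MonomialAlgebra

variable (k) in
/-- The image of a word in `A`. -/
def monomial (F : Finset (List G)) (w : List G) : MonomialAlgebra k F :=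
  RingQuot.mkAlgHom k (MonomialRel k F) (freeWord k w)

theorem monomial_nil (F : Finset (List G)) : monomial k F [] = 1 := by
  simp [monomial, freeWord]

theorem monomial_append (F : Finset (List G)) (v w : List G) :
    monomial k F (v ++ w) = monomial k F v * monomial k F w := by
  simp [monomial, freeWord]

theorem monomial_eq_zero (F : Finset (List G)) {w : List G} (hw : w ∈ F) :
    monomial k F w = 0 := by
  rw [monomial, RingQuot.mkAlgHom_rel k (show MonomialRel k F _ _ from ⟨w, hw, rfl, rfl⟩), map_zero]

/-- The degree of a word, for generators `x` of degree `d x`. -/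
def wordDegree (d : G → ℕ) (w : List G) : ℕ := (w.map d).sum

variable (k) in
/-- The grading of `A` with generators `x` of degree `d x`. -/
def grading (F : Finset (List G)) (d : G → ℕ) (n : ℕ) : Submodule k (MonomialAlgebra k F) :=
  Submodule.span k {a | ∃ w : List G, wordDegree d w = n ∧ a = monomial k F w}

theorem monomial_mem (F : Finset (List G)) (d : G → ℕ) (w : List G) :
    monomial k F w ∈ grading k F d (wordDegree d w) :=
  Submodule.subset_span ⟨w, rfl, rfl⟩

instance (F : Finset (List G)) (d : G → ℕ) : SetLike.GradedMonoid (grading k F d) where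
  one_mem := by
    rw [← monomial_nil]
    exact monomial_mem F d []
  mul_mem i j x y hx hy := by
    induction hx using Submodule.span_induction with
    | zero => rw [zero_mul]; exact zero_mem _
    | add x y _ _ hx hy => rw [add_mul]; exact add_mem hx hy
    | smul r x _ hx => rw [smul_mul_assoc]; exact Submodule.smul_mem _ r hx
    | mem x hx =>
    induction hy using Submodule.span_induction with
    | zero => rw [mul_zero]; exact zero_mem _
    | add x y _ _ hx hy => rw [mul_add]; exact add_mem hx hy
    | smul r x _ hx => rw [mul_smul_comm]; exact Submodule.smul_mem _ r hx
    | mem y hy =>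
    obtain ⟨v, rfl, rfl⟩ := hx
    obtain ⟨w, rfl, rfl⟩ := hy
    exact Submodule.subset_span ⟨v ++ w, by simp [wordDegree], (monomial_append F v w).symm⟩

/-- The decomposition into homogeneous components on the free algebra. -/
def freeDecompose (F : Finset (List G)) (d : G → ℕ) :
    FreeAlgebra k G →ₐ[k] DirectSum ℕ fun n => grading k F d n :=
  FreeAlgebra.lift k fun x => DirectSum.of (fun n => grading k F d n) (wordDegree d [x])
    ⟨monomial k F [x], monomial_mem F d [x]⟩

theorem freeDecompose_freeWord (F : Finset (List G)) (d : G → ℕ) (w : List G) :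
    freeDecompose F d (freeWord k w) =
      DirectSum.of (fun n => grading k F d n) (wordDegree d w)
        ⟨monomial k F w, monomial_mem F d w⟩ := by
  induction w with
  | nil =>
    rw [freeWord, List.map_nil, List.prod_nil, map_one, DirectSum.one_def]
    refine DirectSum.of_eq_of_gradedMonoid_eq (Sigma.subtype_ext rfl ?_)
    exact (monomial_nil F).symm
  | cons x w ih =>
    have h : freeWord k (x :: w) = FreeAlgebra.ι k x * freeWord k w := by simp [freeWord]
    rw [h, map_mul, ih, freeDecompose, FreeAlgebra.lift_ι_apply, DirectSum.of_mul_of]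
    refine DirectSum.of_eq_of_gradedMonoid_eq (Sigma.subtype_ext ?_ ?_)
    · change (List.map d [x]).sum + (List.map d w).sum = (List.map d (x :: w)).sum
      simp
    · exact (monomial_append F [x] w).symm

/-- The decomposition of `A` into homogeneous components. -/
def decomposeHom (F : Finset (List G)) (d : G → ℕ) :
    MonomialAlgebra k F →ₐ[k] DirectSum ℕ fun n => grading k F d n :=
  RingQuot.liftAlgHom k ⟨freeDecompose F d, by
    rintro _ _ ⟨w, hw, rfl, rfl⟩
    rw [freeDecompose_freeWord, map_zero]
    have : (⟨monomial k F w, monomial_mem F d w⟩ : grading k F d (wordDegree d w)) = 0 :=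
      Subtype.ext (monomial_eq_zero F hw)
    rw [this, map_zero]⟩

theorem decomposeHom_monomial (F : Finset (List G)) (d : G → ℕ) (w : List G) :
    decomposeHom F d (monomial k F w) =
      DirectSum.of (fun n => grading k F d n) (wordDegree d w)
        ⟨monomial k F w, monomial_mem F d w⟩ :=
  (RingQuot.liftAlgHom_mkAlgHom_apply k (freeDecompose F d) _ (freeWord k w)).trans
    (freeDecompose_freeWord F d w)

instance (F : Finset (List G)) (d : G → ℕ) : GradedAlgebra (grading k F d) :=
  GradedAlgebra.ofAlgHom (grading k F d) (decomposeHom F d)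
    (by
      apply RingQuot.ringQuot_ext'
      ext x
      have h : RingQuot.mkAlgHom k (MonomialRel k F) (FreeAlgebra.ι k x) = monomial k F [x] := by
        simp [monomial, freeWord]
      simp only [Function.comp_apply, AlgHom.comp_apply, AlgHom.id_apply]
      rw [h, decomposeHom_monomial, DirectSum.coeAlgHom_of])
    (by
      rintro n ⟨x, hx⟩
      dsimp only
      induction hx using Submodule.span_induction with
      | zero => rw [map_zero]; exact (map_zero (DirectSum.of _ n)).symm
      | add x y hx' hy' hx hy => rw [map_add, hx, hy, ← map_add]; rfl
      | smul r x hx' hx =>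
        rw [map_smul, hx]
        exact ((DirectSum.lof k ℕ (fun n => grading k F d n) n).map_smul r _).symm
      | mem x hx =>
        obtain ⟨w, rfl, rfl⟩ := hx
        exact decomposeHom_monomial F d w)

end MonomialAlgebra

/-- A word is legal if it is not in the ideal `(F)`, that is, if no forbidden word occurs in it as
a block of consecutive letters. -/
def Legal (F : Finset (List G)) (w : List G) : Prop := ∀ u ∈ F, ¬ u <:+: w

/-- The number `ℓ`, where `ℓ + 1` is the maximal length of a forbidden word (and `ℓ = 0` if there
is no forbidden word). -/
def ell (F : Finset (List G)) : ℕ := F.sup List.length - 1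

/-- The vertices of the Ufnarovskii graph: the legal words of length `ℓ`. -/
def UfVertex (F : Finset (List G)) : Type u := {w : List G // w.length = ell F ∧ Legal F w}

/-- The arrows of the Ufnarovskii graph are the legal words `w` of length `ℓ + 1`. The arrow
`w = u y = x v`, with letters `x` and `y`, goes from `u` to `v`. -/
instance (F : Finset (List G)) : Quiver.{u} (UfVertex F) where
  Hom u v := {w : List G // w.length = ell F + 1 ∧ Legal F w ∧
    (∃ y, w = u.1 ++ [y]) ∧ ∃ x, w = x :: v.1}

namespace UfVertex

variable {F : Finset (List G)}

/-- The label of an arrow is its first letter. -/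
def label {u v : UfVertex F} (a : u ⟶ v) : G :=
  a.1.head (List.ne_nil_of_length_eq_add_one a.2.1)

theorem eq_label_cons {u v : UfVertex F} (a : u ⟶ v) : a.1 = label a :: v.1 := by
  obtain ⟨x, hx⟩ := a.2.2.2.2
  have : label a = x := by simp [label, hx]
  rw [this, hx]

/-- The degree of an arrow is the degree of its label. -/
def arrowDegree (F : Finset (List G)) (d : G → ℕ) (u v : UfVertex F) (a : u ⟶ v) : ℕ :=
  d (label a)

/-- The label of a path. -/
def pathLabel {u : UfVertex F} : ∀ {v : UfVertex F}, Quiver.Path u v → List G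
  | _, .nil => []
  | _, .cons p a => pathLabel p ++ [label a]

theorem pathLabel_comp {u v w : UfVertex F} (p : Quiver.Path u v) (q : Quiver.Path v w) :
    pathLabel (p.comp q) = pathLabel p ++ pathLabel q := by
  induction q with
  | nil => simp [pathLabel]
  | cons q a ih => simp [pathLabel, ih]

theorem pathDegree_eq (d : G → ℕ) (p : TotalPath (UfVertex F)) :
    PathAlgebra.pathDegree (arrowDegree F d) p =
      MonomialAlgebra.wordDegree d (pathLabel p.2.2) := by
  obtain ⟨u, v, p⟩ := p
  induction p with
  | nil => exact Quiver.Path.addWeight_nil _ u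
  | @cons v w p a ih =>
    have h : MonomialAlgebra.wordDegree d (pathLabel (p.cons a)) =
        MonomialAlgebra.wordDegree d (pathLabel p) + d (label a) := by
      simp [MonomialAlgebra.wordDegree, pathLabel]
    rw [h, ← ih]
    exact Quiver.Path.addWeight_cons _ p a

theorem legal_take {u v : UfVertex F} (p : Quiver.Path u v) :
    Legal F ((pathLabel p ++ v.1).take (ell F + 1)) := by
  induction p with
  | nil =>
    rw [pathLabel, List.nil_append, List.take_of_length_le (by rw [u.2.1]; omega)]
    exact u.2.2
  | @cons v w p a ih =>
    rw [pathLabel, List.append_assoc, List.singleton_append, ← eq_label_cons]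
    obtain ⟨y, hy⟩ := a.2.2.2.1
    cases hp : pathLabel p with
    | nil =>
      rw [List.nil_append, List.take_of_length_le a.2.1.le]
      exact a.2.2.1
    | cons x s =>
      rw [hy, ← List.append_assoc, ← hp, List.take_append_of_le_length]
      · exact ih
      · rw [List.length_append, v.2.1, hp, List.length_cons]
        omega

/-- No path is labelled by a forbidden word. -/
theorem pathLabel_notMem {u v : UfVertex F} (p : Quiver.Path u v) : pathLabel p ∉ F := by
  intro hp
  refine legal_take p _ hp (List.IsPrefix.isInfix ?_)
  refine List.prefix_take_iff.2 ⟨List.prefix_append _ _, ?_⟩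
  have : (pathLabel p).length ≤ F.sup List.length := Finset.le_sup hp
  rw [ell]
  omega

variable [Fintype G]

instance (n : ℕ) (P : List G → Prop) : Finite {w : List G // w.length = n ∧ P w} :=
  ((List.finite_length_eq G n).subset fun _ h => h.1).to_subtype

instance : Fintype (UfVertex F) :=
  @Fintype.ofFinite _ (inferInstanceAs (Finite {w : List G // w.length = ell F ∧ Legal F w}))

instance (u v : UfVertex F) : Fintype (u ⟶ v) :=
  @Fintype.ofFinite _ (inferInstanceAs (Finite {w : List G // w.length = ell F + 1 ∧ Legal F w ∧
    (∃ y, w = u.1 ++ [y]) ∧ ∃ x, w = x :: v.1}))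

open Classical in
variable (k F) in
/-- The sum of all arrows with label `x`. -/
def arrowSum (x : G) : PathAlgebra k (UfVertex F) :=
  ∑ u : UfVertex F, ∑ v : UfVertex F, ∑ a : u ⟶ v,
    if label a = x then PathAlgebra.ofPath k ⟨u, v, a.toPath⟩ else 0

variable (k F) in
/-- The span of the paths with label `w`. -/
def labelSpan (w : List G) : Submodule k (PathAlgebra k (UfVertex F)) :=
  Submodule.span k {x | ∃ p : TotalPath (UfVertex F),
    pathLabel p.2.2 = w ∧ x = PathAlgebra.ofPath k p}

theorem arrowSum_mem (x : G) : arrowSum k F x ∈ labelSpan k F [x] := by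
  classical
  refine sum_mem fun u _ => sum_mem fun v _ => sum_mem fun a _ => ?_
  split_ifs with h
  · exact Submodule.subset_span ⟨⟨u, v, a.toPath⟩, by simp [Quiver.Hom.toPath, pathLabel, h], rfl⟩
  · exact zero_mem _

theorem mul_mem_labelSpan {v w : List G} {x y : PathAlgebra k (UfVertex F)}
    (hx : x ∈ labelSpan k F v) (hy : y ∈ labelSpan k F w) : x * y ∈ labelSpan k F (v ++ w) := by
  induction hx using Submodule.span_induction with
  | zero => rw [zero_mul]; exact zero_mem _
  | add x y _ _ hx hy => rw [add_mul]; exact add_mem hx hy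
  | smul r x _ hx => rw [smul_mul_assoc]; exact Submodule.smul_mem _ r hx
  | mem x hx =>
  induction hy using Submodule.span_induction with
  | zero => rw [mul_zero]; exact zero_mem _
  | add x y _ _ hx hy => rw [mul_add]; exact add_mem hx hy
  | smul r x _ hx => rw [mul_smul_comm]; exact Submodule.smul_mem _ r hx
  | mem y hy =>
  obtain ⟨⟨a, b, p⟩, rfl, rfl⟩ := hx
  obtain ⟨⟨c, d, q⟩, rfl, rfl⟩ := hy
  rw [PathAlgebra.ofPath_mul_ofPath]
  by_cases h : b = c
  · subst h
    rw [PathAlgebra.pathMul_comp]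
    exact Submodule.subset_span ⟨⟨a, d, p.comp q⟩, pathLabel_comp p q, rfl⟩
  · rw [PathAlgebra.pathMul_of_ne _ _ h]
    exact zero_mem _

theorem lift_freeWord_mem (w : List G) :
    FreeAlgebra.lift k (arrowSum k F) (freeWord k w) ∈ labelSpan k F w := by
  induction w with
  | nil =>
    rw [freeWord, List.map_nil, List.prod_nil, map_one, PathAlgebra.one_def]
    exact sum_mem fun v _ => Submodule.subset_span ⟨⟨v, v, Quiver.Path.nil⟩, rfl, rfl⟩
  | cons x w ih =>
    have h : freeWord k (x :: w) = FreeAlgebra.ι k x * freeWord k w := by simp [freeWord]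
    rw [h, map_mul, FreeAlgebra.lift_ι_apply]
    rw [← List.singleton_append]
    have h' := arrowSum_mem (k := k) (F := F) x
    exact mul_mem_labelSpan h' ih

variable (k F) in
/-- The homomorphism `f : A → kQ(A)` that sends a generator `x` to the sum of all arrows with
label `x`. -/
def ufHom : MonomialAlgebra k F →ₐ[k] PathAlgebra k (UfVertex F) :=
  RingQuot.liftAlgHom k ⟨FreeAlgebra.lift k (arrowSum k F), by
    rintro _ _ ⟨w, hw, rfl, rfl⟩
    rw [map_zero]
    refine (Submodule.span_le (p := ⊥)).2 ?_ (lift_freeWord_mem w)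
    rintro _ ⟨p, rfl, rfl⟩
    exact absurd hw (pathLabel_notMem p.2.2)⟩

theorem ufHom_monomial (w : List G) :
    ufHom k F (MonomialAlgebra.monomial k F w) =
      FreeAlgebra.lift k (arrowSum k F) (freeWord k w) :=
  RingQuot.liftAlgHom_mkAlgHom_apply k (FreeAlgebra.lift k (arrowSum k F)) _ (freeWord k w)

/-- `f` sends the generator `x` to the sum of all arrows with label `x`. -/
theorem ufHom_generator (x : G) :
    ufHom k F (MonomialAlgebra.monomial k F [x]) = arrowSum k F x := by
  rw [ufHom_monomial]
  simp [freeWord]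

/-- `f` is a homomorphism of graded algebras. -/
theorem ufHom_mem (d : G → ℕ) (n : ℕ) (a : MonomialAlgebra k F)
    (ha : a ∈ MonomialAlgebra.grading k F d n) :
    ufHom k F a ∈ PathAlgebra.grading k (arrowDegree F d) n := by
  induction ha using Submodule.span_induction with
  | zero => rw [map_zero]; exact zero_mem _
  | add x y _ _ hx hy => rw [map_add]; exact add_mem hx hy
  | smul r x _ hx => rw [map_smul]; exact Submodule.smul_mem _ r hx
  | mem a ha =>
    obtain ⟨w, rfl, rfl⟩ := ha
    rw [ufHom_monomial]
    refine (Submodule.span_le).2 ?_ (lift_freeWord_mem w)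
    rintro _ ⟨p, rfl, rfl⟩
    exact Submodule.subset_span ⟨p, pathDegree_eq d p, rfl⟩

end UfVertex

end MonomialAlgebras

end

/-! Write `B = kQ`. The inverse of `- ⊗_A B` is restriction along `f`. The canonical maps `M → M ⊗_A
B`, `m ↦ m ⊗ 1`, and `N ⊗_A B → N`, `n ⊗ b ↦ n b`, have kernel and cokernel in `Fdim`, so they
become invertible in the quotient categories.

The reason is a family of homomorphisms of left `A`-modules `θ_v : B → A`, one for each legal word
`v` of length `ℓ`: a path with label `w` and target `v` goes to the word `w v`, every other path to
`0`. They satisfy `θ_v(1) = v` and `f(θ_v(b)) = b f(v)` (`retraction_mul`, `retraction_one`,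
`ufHom_retraction`). Tensoring `θ_v` with `M` gives a map `M ⊗_A B → M`, again called `θ_v`, with
`θ_v(m ⊗ 1) = m v` and `t f(v) = θ_v(t) ⊗ 1` (`smul_gen`). So the unit is invertible up to
multiplication by the words `v`, and the counit behaves likewise.

Multiplication by all the `v` is harmless. They generate a right ideal of finite codimension in `A`
(`span_sup_eq_top`), so an element `m` generates a finite-dimensional submodule as soon as every `m
v` does (`IsTorsionElt.of_smul`). The same holds over `B` for the `f(v)`, because `B` is generated
as a left `A`-module by the finitely many trivial paths (`span_idem`). The same two facts show,
without any flatness, that `- ⊗_A B` respects the morphisms to be inverted (`fdimIso_tensor`).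

The structure `CofiniteRetraction` isolates what is needed of `θ`; the combinatorics of words enters
only when it is constructed. -/

noncomputable section

open MulOpposite

open scoped TensorProduct

/-! ### Torsion elements and membership in `Fdim` -/

section Torsion

variable {k : Type u} [Field k] {A : Type u} [Ring A] [Algebra k A]
  {M : Type u} [AddCommGroup M] [Module k M] [Module Aᵐᵒᵖ M] [IsScalarTower k Aᵐᵒᵖ M]
  {N : Type u} [AddCommGroup N] [Module k N] [Module Aᵐᵒᵖ N] [IsScalarTower k Aᵐᵒᵖ N]

variable (k A) in
/-- The map `a ↦ m a`. -/
def orbitMap (m : M) : A →ₗ[k] M where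
  toFun a := op a • m
  map_add' a b := by rw [MulOpposite.op_add, add_smul]
  map_smul' r a := by rw [MulOpposite.op_smul, smul_assoc, RingHom.id_apply]

@[simp]
theorem orbitMap_apply (m : M) (a : A) : orbitMap k A m a = op a • m := rfl

variable (k A) in
/-- An element is torsion if the submodule that it generates is finite-dimensional. -/
def IsTorsionElt (m : M) : Prop := FiniteDimensional k (LinearMap.range (orbitMap k A m))

theorem IsTorsionElt.of_le {m : M} {V : Submodule k M} [FiniteDimensional k V]
    (h : ∀ a : A, op a • m ∈ V) : IsTorsionElt k A m := by
  refine Submodule.finiteDimensional_of_le (S₂ := V) ?_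
  rintro _ ⟨a, rfl⟩
  exact h a

theorem IsTorsionElt.map {m : M} (h : IsTorsionElt k A m) (g : M →ₗ[Aᵐᵒᵖ] N) :
    IsTorsionElt k A (g m) := by
  have : FiniteDimensional k (LinearMap.range (orbitMap k A m)) := h
  refine IsTorsionElt.of_le
    (V := (LinearMap.range (orbitMap k A m)).map (g.restrictScalars k)) fun a => ?_
  exact ⟨op a • m, ⟨a, rfl⟩, by simp⟩

theorem IsTorsionElt.of_injective {m : M} {g : M →ₗ[Aᵐᵒᵖ] N} (hg : Function.Injective g)
    (h : IsTorsionElt k A (g m)) : IsTorsionElt k A m := by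
  have : FiniteDimensional k (LinearMap.range (orbitMap k A (g m))) := h
  refine Module.Finite.of_injective
    ((g.restrictScalars k).restrict (p := LinearMap.range (orbitMap k A m))
      (q := LinearMap.range (orbitMap k A (g m))) ?_)
    fun x y hxy => Subtype.ext (hg (congrArg Subtype.val hxy))
  rintro _ ⟨a, rfl⟩
  exact ⟨a, by simp⟩

theorem isTorsionElt_zero : IsTorsionElt k A (0 : M) :=
  IsTorsionElt.of_le (V := ⊥) fun a => by simp

theorem IsTorsionElt.add {m n : M} (hm : IsTorsionElt k A m) (hn : IsTorsionElt k A n) :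
    IsTorsionElt k A (m + n) := by
  have : FiniteDimensional k (LinearMap.range (orbitMap k A m)) := hm
  have : FiniteDimensional k (LinearMap.range (orbitMap k A n)) := hn
  refine IsTorsionElt.of_le
    (V := LinearMap.range (orbitMap k A m) ⊔ LinearMap.range (orbitMap k A n)) fun a => ?_
  rw [smul_add]
  exact Submodule.add_mem_sup ⟨a, rfl⟩ ⟨a, rfl⟩

/-- A module is in `Fdim` if and only if all its elements are torsion. -/
theorem isFdim_iff : IsFdim k A M ↔ ∀ m : M, IsTorsionElt k A m := by
  constructor
  · intro h m
    have hm : m ∈ sSup {N : Submodule Aᵐᵒᵖ M | FiniteDimensional k N} := by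
      rw [show sSup {N : Submodule Aᵐᵒᵖ M | FiniteDimensional k N} = ⊤ from h]
      trivial
    rw [sSup_eq_iSup'] at hm
    induction hm using Submodule.iSup_induction' with
    | zero => exact isTorsionElt_zero
    | add x y _ _ hx hy => exact hx.add hy
    | mem N x hx =>
      have : FiniteDimensional k (N.1.restrictScalars k) := N.2
      exact IsTorsionElt.of_le (V := N.1.restrictScalars k) fun a => N.1.smul_mem _ hx
  · intro h
    refine eq_top_iff.2 fun m _ => ?_
    have hm : m ∈ Submodule.span Aᵐᵒᵖ {m} := Submodule.mem_span_singleton_self m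
    refine Submodule.mem_sSup_of_mem (show FiniteDimensional k (Submodule.span Aᵐᵒᵖ {m}) from ?_) hm
    have : FiniteDimensional k (LinearMap.range (orbitMap k A m)) := h m
    have : (Submodule.span Aᵐᵒᵖ {m}).restrictScalars k = LinearMap.range (orbitMap k A m) := by
      ext x
      rw [Submodule.restrictScalars_mem, Submodule.mem_span_singleton]
      exact ⟨fun ⟨a, ha⟩ => ⟨unop a, ha⟩, fun ⟨a, ha⟩ => ⟨op a, ha⟩⟩
    change FiniteDimensional k ((Submodule.span Aᵐᵒᵖ {m}).restrictScalars k)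
    rw [this]
    infer_instance

/-- Torsion of an element can be tested in any module that contains it, so the kernel need not be
treated as a module of its own. -/
theorem isFdim_ker_iff {P : Type u} [AddCommGroup P] [Module Aᵐᵒᵖ P] (g : M →ₗ[Aᵐᵒᵖ] P) :
    IsFdim k A (LinearMap.ker g) ↔ ∀ m, g m = 0 → IsTorsionElt k A m := by
  rw [isFdim_iff]
  exact ⟨fun h m hm => (h ⟨m, hm⟩).map (LinearMap.ker g).subtype,
    fun h m => IsTorsionElt.of_injective (LinearMap.ker g).injective_subtype (h m m.2)⟩

theorem isFdim_coker_iff {P : Type u} [AddCommGroup P] [Module Aᵐᵒᵖ P] (g : P →ₗ[Aᵐᵒᵖ] N) :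
    IsFdim k A (N ⧸ LinearMap.range g) ↔
      ∀ n, IsTorsionElt k A ((LinearMap.range g).mkQ n) := by
  rw [isFdim_iff]
  exact ⟨fun h n => h _, fun h x => by
    obtain ⟨n, rfl⟩ := Submodule.mkQ_surjective _ x
    exact h n⟩

theorem isFdim_coker_of_surjective {P : Type u} [AddCommGroup P] [Module Aᵐᵒᵖ P]
    {g : P →ₗ[Aᵐᵒᵖ] N} (hg : Function.Surjective g) :
    IsFdim k A (N ⧸ LinearMap.range g) := by
  rw [isFdim_coker_iff]
  intro n
  have : (LinearMap.range g).mkQ n = 0 := (Submodule.Quotient.mk_eq_zero _).2 (hg n)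
  rw [this]
  exact isTorsionElt_zero

/-- If the right ideal generated by finitely many elements `gen i` has finite codimension, then an
element `m` is torsion as soon as all `m (gen i)` are. -/
theorem IsTorsionElt.of_smul {ι : Type*} [Finite ι] {gen : ι → A} {S : Submodule k A}
    [FiniteDimensional k S] (hS : S ⊔ ⨆ i, LinearMap.range (LinearMap.mulLeft k (gen i)) = ⊤)
    {m : M} (h : ∀ i, IsTorsionElt k A (op (gen i) • m)) : IsTorsionElt k A m := by
  have : ∀ i, FiniteDimensional k (LinearMap.range (orbitMap k A (op (gen i) • m))) := h
  -- From `A = S + ∑ gen i A` one gets `m A = m S + ∑ (m gen i) A`, a finite sum of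
  -- finite-dimensional spaces.
  refine IsTorsionElt.of_le (V := S.map (orbitMap k A m) ⊔
    ⨆ i, LinearMap.range (orbitMap k A (op (gen i) • m))) fun a => ?_
  have ha : a ∈ S ⊔ ⨆ i, LinearMap.range (LinearMap.mulLeft k (gen i)) := hS ▸ trivial
  have := Submodule.mem_map_of_mem (f := orbitMap k A m) ha
  rw [Submodule.map_sup, Submodule.map_iSup] at this
  refine SetLike.le_def.1 (sup_le_sup_left (iSup_mono fun i => ?_) _) this
  rintro _ ⟨_, ⟨b, rfl⟩, rfl⟩
  exact ⟨b, by simp [mul_smul]⟩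

end Torsion

/-! ### Restriction, tensor product, unit and counit -/

section Comparison

variable {k : Type u} [Field k] {A : Type u} [Ring A] [Algebra k A]
  {B : Type u} [Ring B] [Algebra k B] {𝒜 : ℕ → Submodule k A} {ℬ : ℕ → Submodule k B}

/-- The graded right `A`-module underlying a graded right `B`-module. -/
def restrictObj (f : A →ₐ[k] B) (hf : ∀ (n : ℕ) (a : A), a ∈ 𝒜 n → f a ∈ ℬ n) (N : GrMod ℬ) :
    GrMod 𝒜 :=
  letI : Module Aᵐᵒᵖ N.carrier := Module.compHom N.carrier (AlgHom.op f).toRingHom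
  { carrier := N.carrier
    isScalarTower := ⟨fun r a n => by
      change AlgHom.op f (r • a) • n = r • (AlgHom.op f a • n)
      rw [map_smul, smul_assoc]⟩
    deg := N.deg
    isInternal := N.isInternal
    smul_mem := fun {n _ a _} ha hm => N.smul_mem (hf n a ha) hm }

/-- The restriction functor `Gr B ⥤ Gr A`. -/
def restrictFunctor (f : A →ₐ[k] B) (hf : ∀ (n : ℕ) (a : A), a ∈ 𝒜 n → f a ∈ ℬ n) :
    GrMod ℬ ⥤ GrMod 𝒜 where
  obj N := restrictObj f hf N
  map {M N} g :=
    (⟨{ toFun := GrMod.Hom.toLinearMap g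
        map_add' := map_add _
        map_smul' := fun a m => (GrMod.Hom.toLinearMap g).map_smul (AlgHom.op f a) m },
      fun h => GrMod.Hom.map_mem g h⟩ : GrMod.Hom (restrictObj f hf M) (restrictObj f hf N))

section Tensor

variable (f : A →ₐ[k] B) {M : Type u} [AddCommGroup M] [Module k M] [Module Aᵐᵒᵖ M]

/-- The element `m ⊗ b` of `M ⊗_A B`. -/
def pureTensor (m : M) (b : B) : TensorMod f M := Submodule.Quotient.mk (b ⊗ₜ[k] m)

theorem pureTensor_smul (m : M) (a : A) (b : B) :
    pureTensor f (op a • m) b = pureTensor f m (f a * b) :=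
  (Submodule.Quotient.eq _).2 (Submodule.subset_span ⟨m, a, b, rfl⟩)

theorem smul_pureTensor (m : M) (b c : B) :
    op c • pureTensor f m b = pureTensor f m (b * c) := by
  rw [pureTensor, ← Submodule.Quotient.mk_smul, TensorProduct.smul_tmul', op_smul_eq_mul]
  rfl

theorem pureTensor_add (m n : M) (b : B) :
    pureTensor f (m + n) b = pureTensor f m b + pureTensor f n b := by
  rw [pureTensor, TensorProduct.tmul_add, Submodule.Quotient.mk_add]
  rfl

variable {f} in
theorem TensorMod.induction {P : TensorMod f M → Prop} (t : TensorMod f M) (zero : P 0)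
    (add : ∀ x y, P x → P y → P (x + y)) (pure : ∀ m b, P (pureTensor f m b)) : P t := by
  obtain ⟨t, rfl⟩ := Submodule.Quotient.mk_surjective _ t
  induction t using TensorProduct.induction_on with
  | zero => exact zero
  | add x y hx hy => exact add _ _ hx hy
  | tmul b m => exact pure m b

variable {f} in
theorem TensorMod.hom_ext {P : Type u} [AddCommGroup P] [Module Bᵐᵒᵖ P]
    {g h : TensorMod f M →ₗ[Bᵐᵒᵖ] P} (H : ∀ m b, g (pureTensor f m b) = h (pureTensor f m b)) :
    g = h := by
  refine LinearMap.ext fun t => ?_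
  induction t using TensorMod.induction with
  | zero => rw [map_zero, map_zero]
  | add x y hx hy => rw [map_add, map_add, hx, hy]
  | pure m b => exact H m b

variable [IsScalarTower k Aᵐᵒᵖ M]

/-- The map `M ⊗_A B → M` induced by a homomorphism `θ : B → A` of left `A`-modules. -/
def tensorRetract (θ : B →ₗ[k] A) (hθ : ∀ a b, θ (f a * b) = a * θ b) :
    TensorMod f M →ₗ[k] M :=
  ((tensorRel f M).restrictScalars k).liftQ
    (TensorProduct.lift (LinearMap.mk₂ k (fun (b : B) (m : M) => op (θ b) • m)
      (fun b c m => by rw [map_add, MulOpposite.op_add, add_smul])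
      (fun r b m => by rw [map_smul, MulOpposite.op_smul, smul_assoc])
      (fun b m n => smul_add _ _ _)
      (fun r b m => smul_comm _ _ _)))
    (by
      intro t ht
      -- The map is only `k`-linear while `tensorRel` is a span over `Bᵐᵒᵖ`, so the relations are
      -- first rewritten as a `k`-span of the same generators.
      refine (Submodule.span_le (p := LinearMap.ker _)).2 ?_ (tensorRel_eq_span f M t ht)
      rintro _ ⟨m, a, b, rfl⟩
      simp [hθ, mul_smul])

theorem tensorRetract_pure (θ : B →ₗ[k] A) (hθ : ∀ a b, θ (f a * b) = a * θ b) (m : M) (b : B) :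
    tensorRetract f θ hθ (pureTensor f m b) = op (θ b) • m := rfl

end Tensor

section Counit

variable (f : A →ₐ[k] B) {N : Type u} [AddCommGroup N] [Module k N] [Module Bᵐᵒᵖ N]
  [IsScalarTower k Bᵐᵒᵖ N] [Module Aᵐᵒᵖ N] (hN : ∀ (a : A) (n : N), op a • n = op (f a) • n)

/-- The multiplication map `N ⊗_A B → N`. -/
def tensorAction : TensorMod f N →ₗ[Bᵐᵒᵖ] N :=
  (tensorRel f N).liftQ
    (TensorProduct.AlgebraTensorModule.lift
      { toFun := fun b =>
          { toFun := fun n => op b • n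
            map_add' := smul_add _
            map_smul' := fun r n => smul_comm _ _ _ }
        map_add' := fun b c => by
          ext n
          exact add_smul (op b) (op c) n
        map_smul' := fun c b => by
          ext n
          exact mul_smul c (op b) n })
    (by
      rw [tensorRel, Submodule.span_le]
      rintro _ ⟨n, a, b, rfl⟩
      simp [hN, mul_smul])

end Counit

variable (f : A →ₐ[k] B) (hf : ∀ (n : ℕ) (a : A), a ∈ 𝒜 n → f a ∈ ℬ n)

/-- The multiplication map `N ⊗_A B → N` for a graded module `N`. -/
def counitMap (N : GrMod ℬ) : TensorMod f (restrictObj f hf N).carrier →ₗ[Bᵐᵒᵖ] N.carrier :=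
  letI : Module Aᵐᵒᵖ N.carrier := (restrictObj f hf N).module
  tensorAction f (N := N.carrier) fun _ _ => rfl

theorem counitMap_mem (N : GrMod ℬ) (n : ℤ) (t : TensorMod f (restrictObj f hf N).carrier)
    (ht : t ∈ tensorDeg ℬ f (restrictObj f hf N) n) : counitMap f hf N t ∈ N.deg n := by
  induction ht using Submodule.span_induction with
  | mem t ht =>
    obtain ⟨i, j, m, b, rfl, hm, hb, rfl⟩ := ht
    exact N.smul_mem hb hm
  | zero => rw [map_zero]; exact zero_mem _
  | add x y _ _ hx hy => rw [map_add]; exact add_mem hx hy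
  | smul r x _ hx => rw [LinearMap.map_smul_of_tower]; exact Submodule.smul_mem _ r hx

theorem pureTensor_one_mem [SetLike.GradedOne ℬ] (M : GrMod 𝒜) (i : ℤ) (m : M.carrier)
    (hm : m ∈ M.deg i) : pureTensor f m 1 ∈ tensorDeg ℬ f M i :=
  Submodule.subset_span ⟨i, 0, m, 1, by simp, hm, SetLike.GradedOne.one_mem, rfl⟩

variable [GradedAlgebra 𝒜] [GradedAlgebra ℬ]

/-- The natural transformation `m ↦ m ⊗ 1`. -/
def tensorUnit : 𝟭 (GrMod 𝒜) ⟶ tensorFunctor f hf ⋙ restrictFunctor f hf where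
  app M := (⟨{ toFun := fun m : M.carrier => pureTensor f m 1
               map_add' := fun m n => pureTensor_add f m n 1
               map_smul' := fun a m => by
                 change _ = op (f (unop a)) • pureTensor f m 1
                 -- Linearity is `m a ⊗ 1 = m ⊗ f(a) = (m ⊗ 1) f(a)`.
                 rw [smul_pureTensor, one_mul, ← mul_one (f (unop a)), ← pureTensor_smul,
                   op_unop] },
      fun {i m} hm => pureTensor_one_mem f M i m hm⟩ :
    GrMod.Hom M (restrictObj f hf (tensorObj f hf M)))
  naturality M N g := rfl

/-- The natural transformation `n ⊗ b ↦ n b`. -/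
def tensorCounit : restrictFunctor f hf ⋙ tensorFunctor f hf ⟶ 𝟭 (GrMod ℬ) where
  app N := (⟨counitMap f hf N, fun {n t} ht => counitMap_mem f hf N n t ht⟩ :
    GrMod.Hom (tensorObj f hf (restrictObj f hf N)) N)
  naturality M N g := by
    refine GrMod.hom_ext (TensorMod.hom_ext (f := f) fun m b => ?_)
    exact ((GrMod.Hom.toLinearMap g).map_smul (op b) (show M.carrier from m)).symm

/-- The canonical isomorphism `M(1) ⊗_A B ≅ (M ⊗_A B)(1)`. -/
def tensorShiftIso : GrMod.shift 𝒜 ⋙ tensorFunctor f hf ≅ tensorFunctor f hf ⋙ GrMod.shift ℬ :=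
  -- The underlying modules agree, so the identity map works once the gradings are matched by moving
  -- the shift to the degree of the factor in `M`.
  have h (M : GrMod 𝒜) (n : ℤ) : tensorDeg ℬ f M.shiftObj n = tensorDeg ℬ f M (n + 1) := by
    refine congrArg (Submodule.span k) (Set.ext fun t => ⟨?_, ?_⟩)
    · rintro ⟨i, j, m, b, rfl, hm, hb, rfl⟩
      exact ⟨i + 1, j, m, b, by ring, hm, hb, rfl⟩
    · rintro ⟨i, j, m, b, hij, hm, hb, rfl⟩
      refine ⟨i - 1, j, m, b, by omega, ?_, hb, rfl⟩
      change m ∈ M.deg (i - 1 + 1)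
      rwa [sub_add_cancel]
  NatIso.ofComponents (fun M =>
    { hom := (⟨LinearMap.id, fun {n _} ht => (h M n).le ht⟩ :
        GrMod.Hom (tensorObj f hf M.shiftObj) (tensorObj f hf M).shiftObj)
      inv := (⟨LinearMap.id, fun {n _} ht => (h M n).ge ht⟩ :
        GrMod.Hom (tensorObj f hf M).shiftObj (tensorObj f hf M.shiftObj))
      hom_inv_id := rfl
      inv_hom_id := rfl })
    fun _ => rfl

end Comparison

/-! ### Torsion in cokernels -/

section TorsionQuotient

variable {k : Type u} [Field k] {A : Type u} [Ring A] [Algebra k A]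
  {N : Type u} [AddCommGroup N] [Module k N] [Module Aᵐᵒᵖ N] [IsScalarTower k Aᵐᵒᵖ N]

/-- A finite spanning set of the cyclic submodule of `N ⧸ P` lifts to `N`. The right-hand side is an
inclusion of subspaces of `N`, so it can be carried from `A` to `B` and back, although the quotients
are modules over different rings. -/
theorem isTorsionElt_mkQ_iff (P : Submodule Aᵐᵒᵖ N) (n : N) :
    IsTorsionElt k A (P.mkQ n) ↔ ∃ V : Submodule k N, FiniteDimensional k V ∧
      ∀ a : A, op a • n ∈ V ⊔ P.restrictScalars k := by
  constructor
  · intro h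
    obtain ⟨s, hs⟩ := (Submodule.fg_iff_finiteDimensional _).2 h
    obtain ⟨σ, hσ⟩ := (Submodule.mkQ_surjective P).hasRightInverse
    classical
    refine ⟨Submodule.span k (s.image σ : Finset N), FiniteDimensional.span_finset k _, fun a => ?_⟩
    have ha : P.mkQ (op a • n) ∈ Submodule.span k (s : Set (N ⧸ P)) := by
      rw [hs]
      exact ⟨a, by simp⟩
    have hs' : (s : Set (N ⧸ P)) = (P.mkQ.restrictScalars k) '' (s.image σ : Finset N) := by
      rw [Finset.coe_image, Set.image_image]
      exact (Set.image_id _).symm.trans (Set.image_congr fun x _ => (hσ x).symm)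
    rw [hs', ← Submodule.map_span] at ha
    obtain ⟨v, hv, hva⟩ := ha
    have : op a • n - v ∈ P := (Submodule.Quotient.eq P).1 hva.symm
    rw [← sub_add_cancel (op a • n) v, add_comm]
    exact Submodule.add_mem_sup hv this
  · rintro ⟨V, hV, h⟩
    refine IsTorsionElt.of_le (V := V.map (P.mkQ.restrictScalars k)) fun a => ?_
    obtain ⟨v, hv, p, hp, hvp⟩ := Submodule.mem_sup.1 (h a)
    refine ⟨v, hv, ?_⟩
    rw [← map_smul, ← hvp, map_add]
    have : P.mkQ p = 0 := (Submodule.Quotient.mk_eq_zero _).2 hp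
    rw [this, add_zero]
    rfl

theorem isFdim_coker_iff_exists {P : Type u} [AddCommGroup P] [Module Aᵐᵒᵖ P] (g : P →ₗ[Aᵐᵒᵖ] N) :
    IsFdim k A (N ⧸ LinearMap.range g) ↔ ∀ n : N, ∃ V : Submodule k N, FiniteDimensional k V ∧
      ∀ a : A, op a • n ∈ V ⊔ (LinearMap.range g).restrictScalars k := by
  rw [isFdim_coker_iff]
  exact forall_congr' fun n => isTorsionElt_mkQ_iff _ n

end TorsionQuotient

/-! ### Cofinite retractions induce equivalences -/

section Comparison

variable {k : Type u} [Field k] {A : Type u} [Ring A] [Algebra k A]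
  {B : Type u} [Ring B] [Algebra k B]

/-- Elements `gen i` of `A` that generate a right ideal of finite codimension, with homomorphisms
of left `A`-modules `θ i : B → A` such that `a ↦ θ i (f a)` and `b ↦ f (θ i b)` are the right
multiplications by `gen i` and `f (gen i)`; moreover, `B` is a finitely generated left
`A`-module. -/
structure CofiniteRetraction (f : A →ₐ[k] B) where
  ι : Type u
  [finite_ι : Finite ι]
  gen : ι → A
  residue : Submodule k A
  [finite_residue : FiniteDimensional k residue]
  residue_sup : residue ⊔ ⨆ i, LinearMap.range (LinearMap.mulLeft k (gen i)) = ⊤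
  θ : ι → B →ₗ[k] A
  θ_mul : ∀ i a b, θ i (f a * b) = a * θ i b
  θ_one : ∀ i, θ i 1 = gen i
  map_θ : ∀ i b, f (θ i b) = b * f (gen i)
  κ : Type u
  [finite_κ : Finite κ]
  e : κ → B
  span_e : ⨆ j, LinearMap.range (LinearMap.mulRight k (e j) ∘ₗ f.toLinearMap) = ⊤

namespace CofiniteRetraction

attribute [instance] finite_ι finite_residue finite_κ

variable {f : A →ₐ[k] B} (C : CofiniteRetraction f)

section Modules

variable {M : Type u} [AddCommGroup M] [Module k M] [Module Aᵐᵒᵖ M] [IsScalarTower k Aᵐᵒᵖ M]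

theorem retract_pure_one (i : C.ι) (m : M) :
    tensorRetract f (C.θ i) (C.θ_mul i) (pureTensor f m 1) = op (C.gen i) • m := by
  rw [tensorRetract_pure, C.θ_one]

/-- On pure tensors, `(m ⊗ b) f(gen i) = m ⊗ f(θ i b) = m (θ i b) ⊗ 1`. Multiplication by `f (gen
i)` thus moves every tensor into the image of the unit, which reduces the torsion questions below to
elements `m ⊗ 1`. -/
theorem smul_gen (i : C.ι) (t : TensorMod f M) :
    op (f (C.gen i)) • t = pureTensor f (tensorRetract f (C.θ i) (C.θ_mul i) t) 1 := by
  induction t using TensorMod.induction with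
  | zero => rw [smul_zero, map_zero, pureTensor, TensorProduct.tmul_zero, Submodule.Quotient.mk_zero]
  | add x y hx hy => rw [smul_add, hx, hy, map_add, pureTensor_add]
  | pure m b =>
    rw [smul_pureTensor, tensorRetract_pure, pureTensor_smul, mul_one, C.map_θ]

/-- Finite codimension passes from `A` to `B`: apply `f` to `A = residue + ∑ gen i A` and multiply
by the finitely many `e j`. The terms `f(gen i) f(A) e j` lie in `f(gen i) B`, and `∑ f(residue) e
j` is finite-dimensional. -/
theorem exists_map_residue_sup : ∃ S : Submodule k B, FiniteDimensional k S ∧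
    S ⊔ ⨆ i, LinearMap.range (LinearMap.mulLeft k (f (C.gen i))) = ⊤ := by
  refine ⟨⨆ j, C.residue.map (LinearMap.mulRight k (C.e j) ∘ₗ f.toLinearMap), inferInstance, ?_⟩
  rw [eq_top_iff, ← C.span_e]
  refine iSup_le fun j => ?_
  rw [LinearMap.range_eq_map, ← C.residue_sup, Submodule.map_sup, Submodule.map_iSup]
  refine sup_le_sup (le_iSup (fun j => C.residue.map
    (LinearMap.mulRight k (C.e j) ∘ₗ f.toLinearMap)) j) (iSup_mono fun i => ?_)
  rintro _ ⟨_, ⟨a, rfl⟩, rfl⟩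
  exact ⟨f a * C.e j, by simp [mul_assoc]⟩

variable {N : Type u} [AddCommGroup N] [Module k N] [Module Bᵐᵒᵖ N] [IsScalarTower k Bᵐᵒᵖ N]

include C in
theorem isTorsionElt_of_smul {n : N} (h : ∀ i, IsTorsionElt k B (op (f (C.gen i)) • n)) :
    IsTorsionElt k B n := by
  obtain ⟨S, hS, hS'⟩ := C.exists_map_residue_sup
  exact IsTorsionElt.of_smul hS' h

variable (f M) in
/-- The map `m ↦ m ⊗ b`. -/
def pureTensorLeft (b : B) : M →ₗ[k] TensorMod f M :=
  (tensorRel f M).mkQ.restrictScalars k ∘ₗ TensorProduct.mk k B M b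

/-- If `b = ∑ f(a_j) e j`, then `m ⊗ b = ∑ m a_j ⊗ e j`. So `m ⊗ B` is covered by finitely many
images of `m A` and inherits its finite-dimensionality. -/
theorem pureTensor_mem (m : M) (b : B) :
    pureTensor f m b ∈ ⨆ j, (LinearMap.range (orbitMap k A m)).map (pureTensorLeft f M (C.e j)) := by
  have hb : b ∈ ⨆ j, LinearMap.range (LinearMap.mulRight k (C.e j) ∘ₗ f.toLinearMap) :=
    C.span_e ▸ trivial
  induction hb using Submodule.iSup_induction' with
  | zero => rw [pureTensor, TensorProduct.zero_tmul, Submodule.Quotient.mk_zero]; exact zero_mem _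
  | add x y _ _ hx hy =>
    rw [pureTensor, TensorProduct.add_tmul, Submodule.Quotient.mk_add]; exact add_mem hx hy
  | mem j b hb =>
    obtain ⟨a, rfl⟩ := hb
    exact Submodule.mem_iSup_of_mem j ⟨op a • m, ⟨a, rfl⟩, pureTensor_smul f m a (C.e j)⟩

include C in
theorem isTorsionElt_pureTensor_one {m : M} (h : IsTorsionElt k A m) :
    IsTorsionElt k B (pureTensor f m 1) := by
  have : FiniteDimensional k (LinearMap.range (orbitMap k A m)) := h
  refine IsTorsionElt.of_le (V := ⨆ j, (LinearMap.range (orbitMap k A m)).map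
    (pureTensorLeft f M (C.e j))) fun b => ?_
  rw [smul_pureTensor, one_mul]
  exact C.pureTensor_mem m b

end Modules

variable {𝒜 : ℕ → Submodule k A} {ℬ : ℕ → Submodule k B}
  (hf : ∀ (n : ℕ) (a : A), a ∈ 𝒜 n → f a ∈ ℬ n)

/-- The orbit of an element under `f(A)` lies in its orbit under `B`, so the finite-dimensional
spaces found over `B` serve over `A` too. -/
theorem fdimIso_restrict {M N : GrMod ℬ} {g : M ⟶ N} (hg : fdimIso ℬ g) :
    fdimIso 𝒜 ((restrictFunctor f hf).map g) := by
  have h (m : M.carrier) (hm : GrMod.Hom.toLinearMap g m = 0) :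
      ∃ V : Submodule k M.carrier, FiniteDimensional k V ∧ ∀ b : B, op b • m ∈ V :=
    ⟨_, (isFdim_ker_iff _).1 hg.1 m hm, fun b => ⟨b, rfl⟩⟩
  refine ⟨(isFdim_ker_iff _).2 fun m hm => ?_,
    (isFdim_coker_iff_exists _).2 fun (n : N.carrier) => ?_⟩
  · obtain ⟨V, hV, h⟩ := h m hm
    exact @IsTorsionElt.of_le k _ A _ _ _ _ _ _ _ _ V hV fun a => h (f a)
  · obtain ⟨V, hV, h⟩ := (isFdim_coker_iff_exists _).1 hg.2 n
    exact ⟨V, hV, fun a => h (f a)⟩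

variable [GradedAlgebra 𝒜] [GradedAlgebra ℬ]

include C in
-- Kernel and cokernel are annihilated by every `gen i`: if `m ⊗ 1 = 0`, applying the retraction
-- gives `m gen i = 0`, and `smul_gen` puts `t f(gen i)` into the image.
theorem fdimIso_unit (M : GrMod 𝒜) : fdimIso 𝒜 ((tensorUnit f hf).app M) := by
  refine ⟨(isFdim_ker_iff _).2 fun m hm => IsTorsionElt.of_smul C.residue_sup fun i => ?_,
    (isFdim_coker_iff _).2 fun t => IsTorsionElt.of_smul C.residue_sup fun i => ?_⟩
  · have hm' : pureTensor f m 1 = 0 := hm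
    rw [← C.retract_pure_one, hm', map_zero]
    exact isTorsionElt_zero
  · rw [← map_smul]
    refine Eq.mpr (congrArg (IsTorsionElt k A) ?_) isTorsionElt_zero
    exact (Submodule.Quotient.mk_eq_zero _).2 ⟨_, (C.smul_gen i t).symm⟩

include C in
theorem fdimIso_counit (N : GrMod ℬ) : fdimIso ℬ ((tensorCounit f hf).app N) := by
  refine ⟨(isFdim_ker_iff _).2 fun t ht => C.isTorsionElt_of_smul fun i => ?_,
    isFdim_coker_of_surjective fun n =>
      ⟨pureTensor f (M := (restrictObj f hf N).carrier) n 1, one_smul _ n⟩⟩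
  -- On `n ⊗ b` both sides are `n b f(gen i)`. By `smul_gen` an element killed by the counit is
  -- therefore annihilated by every `f (gen i)`.
  have key (t : TensorMod f (restrictObj f hf N).carrier) :
      tensorRetract f (C.θ i) (C.θ_mul i) t = op (f (C.gen i)) • counitMap f hf N t := by
    induction t using TensorMod.induction with
    | zero => rw [map_zero, map_zero, smul_zero]; rfl
    | add x y hx hy => rw [map_add, map_add, smul_add, hx, hy]; rfl
    | pure n b =>
      change op (f (C.θ i b)) • (show N.carrier from n) = _
      rw [C.map_θ, MulOpposite.op_mul, mul_smul]
      rfl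
  have ht' : counitMap f hf N t = 0 := ht
  refine Eq.mpr (congrArg (IsTorsionElt k B) ((C.smul_gen i t).trans ?_)) isTorsionElt_zero
  exact (congrArg (pureTensor f · 1) ((key t).trans
    ((congrArg (op (f (C.gen i)) • · : N.carrier → N.carrier) ht').trans (smul_zero _)))).trans
    (pureTensorLeft f _ 1).map_zero

include C in
-- The retraction `M ⊗_A B → M` is natural in `M`, so it carries the kernel of `g ⊗ B` to the
-- torsion module `ker g`. For the cokernel, an inclusion `n A ⊆ V + im g` yields `n ⊗ B ⊆ ∑ V ⊗ e j
-- + im (g ⊗ B)`.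
theorem fdimIso_tensor {M N : GrMod 𝒜} {g : M ⟶ N} (hg : fdimIso 𝒜 g) :
    fdimIso ℬ ((tensorFunctor f hf).map g) := by
  have key (i : C.ι) (t : TensorMod f M.carrier) :
      tensorRetract f (C.θ i) (C.θ_mul i) (tensorMap f g t) =
        GrMod.Hom.toLinearMap g (tensorRetract f (C.θ i) (C.θ_mul i) t) := by
    induction t using TensorMod.induction with
    | zero => simp
    | add x y hx hy => simp only [map_add, hx, hy]
    | pure m b => exact ((GrMod.Hom.toLinearMap g).map_smul (op (C.θ i b)) m).symm
  refine ⟨(isFdim_ker_iff _).2 fun (t : TensorMod f M.carrier) ht =>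
      C.isTorsionElt_of_smul fun i => ?_,
    (isFdim_coker_iff _).2 fun t => C.isTorsionElt_of_smul fun i => ?_⟩
  · have ht' : tensorMap f g t = 0 := ht
    refine Eq.mpr (congrArg (IsTorsionElt k B) (C.smul_gen i t))
      (C.isTorsionElt_pureTensor_one ((isFdim_ker_iff _).1 hg.1 _ ?_))
    rw [← key, ht', map_zero]
  · rw [← map_smul]
    refine Eq.mpr (congrArg (fun x => IsTorsionElt k B (Submodule.mkQ _ x)) (C.smul_gen i t)) ?_
    obtain ⟨V, hV, h⟩ := (isFdim_coker_iff_exists _).1 hg.2 (tensorRetract f (C.θ i) (C.θ_mul i) t)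
    generalize tensorRetract f (C.θ i) (C.θ_mul i) t = n at h
    refine (isTorsionElt_mkQ_iff _ _).2 ⟨⨆ j, V.map (pureTensorLeft f N.carrier (C.e j)),
      inferInstanceAs (FiniteDimensional k
        (⨆ j, V.map (pureTensorLeft f N.carrier (C.e j)) : Submodule k (TensorMod f N.carrier))),
      fun b => ?_⟩
    have h1 : op b • pureTensor f n 1 = pureTensor f n b := by rw [smul_pureTensor, one_mul]
    refine Eq.mpr (congrArg (· ∈ _) h1) ?_
    refine SetLike.le_def.1 (iSup_le fun j => ?_) (C.pureTensor_mem n b)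
    rintro _ ⟨_, ⟨a, rfl⟩, rfl⟩
    obtain ⟨v, hv, _, ⟨m, rfl⟩, hvm⟩ := Submodule.mem_sup.1 (h a)
    rw [orbitMap_apply, ← hvm, map_add]
    exact Submodule.add_mem_sup (Submodule.mem_iSup_of_mem j ⟨v, hv, rfl⟩)
      ⟨pureTensor f m (C.e j), rfl⟩

include C in
/-- A cofinite retraction makes `- ⊗_A B` induce an equivalence `QGr A ≌ QGr B`, which commutes
with the shift functors. -/
theorem exists_equivalence : ∃ E : QGr 𝒜 ≌ QGr ℬ,
    Nonempty (QGr.proj 𝒜 ⋙ E.functor ≅ tensorFunctor f hf ⋙ QGr.proj ℬ) ∧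
      Nonempty (QGr.shift 𝒜 ⋙ E.functor ≅ E.functor ⋙ QGr.shift ℬ) := by
  let T := tensorFunctor (𝒜 := 𝒜) (ℬ := ℬ) f hf
  let R := restrictFunctor (𝒜 := 𝒜) (ℬ := ℬ) f hf
  have hT : (fdimIso 𝒜).IsInvertedBy (T ⋙ QGr.proj ℬ) := fun _ _ g hg =>
    Localization.inverts (QGr.proj ℬ) (fdimIso ℬ) _ (C.fdimIso_tensor hf hg)
  have hR : (fdimIso ℬ).IsInvertedBy (R ⋙ QGr.proj 𝒜) := fun _ _ g hg =>
    Localization.inverts (QGr.proj 𝒜) (fdimIso 𝒜) _ (fdimIso_restrict hf hg)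
  let Φ := Localization.lift (T ⋙ QGr.proj ℬ) hT (QGr.proj 𝒜)
  let Ψ := Localization.lift (R ⋙ QGr.proj 𝒜) hR (QGr.proj ℬ)
  let facΦ : QGr.proj 𝒜 ⋙ Φ ≅ T ⋙ QGr.proj ℬ := Localization.fac _ hT _
  let facΨ : QGr.proj ℬ ⋙ Ψ ≅ R ⋙ QGr.proj 𝒜 := Localization.fac _ hR _
  have (M : GrMod 𝒜) : IsIso ((Functor.whiskerRight (tensorUnit f hf) (QGr.proj 𝒜)).app M) :=
    Localization.inverts (QGr.proj 𝒜) (fdimIso 𝒜) _ (C.fdimIso_unit hf M)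
  have (N : GrMod ℬ) : IsIso ((Functor.whiskerRight (tensorCounit f hf) (QGr.proj ℬ)).app N) :=
    Localization.inverts (QGr.proj ℬ) (fdimIso ℬ) _ (C.fdimIso_counit hf N)
  have : IsIso (Functor.whiskerRight (tensorUnit f hf) (QGr.proj 𝒜)) :=
    NatIso.isIso_of_isIso_app _
  have : IsIso (Functor.whiskerRight (tensorCounit f hf) (QGr.proj ℬ)) :=
    NatIso.isIso_of_isIso_app _
  let unitIso := asIso (Functor.whiskerRight (tensorUnit f hf) (QGr.proj 𝒜))
  let counitIso := asIso (Functor.whiskerRight (tensorCounit f hf) (QGr.proj ℬ))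
  let α : (T ⋙ QGr.proj ℬ) ⋙ Ψ ≅ QGr.proj 𝒜 :=
    Functor.isoWhiskerLeft T facΨ ≪≫ unitIso.symm
  let β : (R ⋙ QGr.proj 𝒜) ⋙ Φ ≅ QGr.proj ℬ :=
    Functor.isoWhiskerLeft R facΦ ≪≫ counitIso
  -- The two isomorphisms `α` and `β` suffice; no triangle identity between unit and counit has to
  -- be checked.
  let E := Localization.equivalence (QGr.proj 𝒜) (fdimIso 𝒜) (QGr.proj ℬ) (fdimIso ℬ)
    (T ⋙ QGr.proj ℬ) Φ (R ⋙ QGr.proj 𝒜) Ψ α β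
  have shiftA : QGr.proj 𝒜 ⋙ QGr.shift 𝒜 = GrMod.shift 𝒜 ⋙ QGr.proj 𝒜 :=
    Localization.Construction.fac _ _
  have shiftB : QGr.proj ℬ ⋙ QGr.shift ℬ = GrMod.shift ℬ ⋙ QGr.proj ℬ :=
    Localization.Construction.fac _ _
  -- An isomorphism of functors on `QGr 𝒜` may be constructed after precomposition with the quotient
  -- functor, where it reduces to `tensorShiftIso`.
  let e : QGr.proj 𝒜 ⋙ QGr.shift 𝒜 ⋙ Φ ≅ QGr.proj 𝒜 ⋙ Φ ⋙ QGr.shift ℬ :=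
    Functor.isoWhiskerRight (eqToIso shiftA) Φ ≪≫
      Functor.isoWhiskerLeft (GrMod.shift 𝒜) facΦ ≪≫
      Functor.isoWhiskerRight (tensorShiftIso f hf) (QGr.proj ℬ) ≪≫
      Functor.isoWhiskerLeft T (eqToIso shiftB.symm) ≪≫
      Functor.isoWhiskerRight facΦ.symm (QGr.shift ℬ)
  have : Localization.Lifting (QGr.proj 𝒜) (fdimIso 𝒜) (QGr.proj 𝒜 ⋙ QGr.shift 𝒜 ⋙ Φ)
      (QGr.shift 𝒜 ⋙ Φ) := ⟨Iso.refl _⟩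
  have : Localization.Lifting (QGr.proj 𝒜) (fdimIso 𝒜) (QGr.proj 𝒜 ⋙ Φ ⋙ QGr.shift ℬ)
      (Φ ⋙ QGr.shift ℬ) := ⟨Iso.refl _⟩
  exact ⟨E, ⟨facΦ⟩, ⟨Localization.liftNatIso (QGr.proj 𝒜) (fdimIso 𝒜)
    (QGr.proj 𝒜 ⋙ QGr.shift 𝒜 ⋙ Φ) (QGr.proj 𝒜 ⋙ Φ ⋙ QGr.shift ℬ)
    (QGr.shift 𝒜 ⋙ Φ) (Φ ⋙ QGr.shift ℬ) e⟩⟩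

end CofiniteRetraction

end Comparison

/-! ### Words, arrows and the retractions of the Ufnarovskii graph -/

section Ufnarovskii

variable {k : Type u} [Field k] {G : Type u} {F : Finset (List G)}

theorem Legal.of_infix {v w : List G} (hw : Legal F w) (h : v <:+: w) : Legal F v :=
  fun u hu huv => hw u hu (huv.trans h)

namespace MonomialAlgebra

/-- Only this half of the monomial basis theorem is needed; linear independence of the legal words
plays no role. -/
theorem monomial_eq_zero_of_not_legal {w : List G} (hw : ¬ Legal F w) : monomial k F w = 0 := by
  rw [Legal] at hw
  push Not at hw
  obtain ⟨u, hu, s, t, rfl⟩ := hw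
  rw [monomial_append, monomial_append, monomial_eq_zero F hu, mul_zero, zero_mul]

variable (k F) in
theorem span_monomial : Submodule.span k (Set.range (monomial k F)) = ⊤ := by
  -- The degrees are irrelevant here: for any choice the components are spanned by words and add up
  -- to `A`.
  have h := (DirectSum.isInternal_submodule_iff_iSupIndep_and_iSup_eq_top _).1
    (DirectSum.Decomposition.isInternal (grading k F fun _ => 0)) |>.2
  rw [eq_top_iff, ← h]
  refine iSup_le fun n => Submodule.span_mono ?_
  rintro _ ⟨w, -, rfl⟩
  exact ⟨w, rfl⟩

variable (k F) in
/-- The words of length less than `n` span a complement of the right ideal generated by the legal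
words of length `n`. -/
theorem span_sup_eq_top (n : ℕ) :
    Submodule.span k (monomial k F '' {w | w.length < n}) ⊔
      ⨆ v : {v : List G // v.length = n ∧ Legal F v},
        LinearMap.range (LinearMap.mulLeft k (monomial k F v.1)) = ⊤ := by
  rw [eq_top_iff, ← span_monomial, Submodule.span_le]
  rintro _ ⟨w, rfl⟩
  by_cases hw : w.length < n
  · exact Submodule.mem_sup_left (Submodule.subset_span ⟨w, hw, rfl⟩)
  · by_cases hl : Legal F w
    -- A legal word with at least `n` letters is a left multiple of its remaining letters by its
    -- prefix of length `n`, which is again legal.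
    · refine Submodule.mem_sup_right (Submodule.mem_iSup_of_mem
        ⟨w.take n, by rw [List.length_take]; omega, hl.of_infix (List.take_prefix n w).isInfix⟩
        ⟨monomial k F (w.drop n), ?_⟩)
      rw [LinearMap.mulLeft_apply, ← monomial_append, List.take_append_drop]
    · rw [monomial_eq_zero_of_not_legal hl]
      exact zero_mem _

end MonomialAlgebra

namespace UfVertex

theorem label_eq_of_cons {u v : UfVertex F} (a : u ⟶ v) {x : G} (h : a.1 = x :: v.1) :
    label a = x := by
  rw [eq_label_cons] at h
  exact (List.cons.inj h).1

/-- An arrow is determined by its label and its target. -/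
theorem arrow_ext {u u' v : UfVertex F} (a : u ⟶ v) (a' : u' ⟶ v) (h : label a = label a') :
    (⟨u, a⟩ : Σ u : UfVertex F, u ⟶ v) = ⟨u', a'⟩ := by
  have hw : a.1 = a'.1 := by rw [eq_label_cons, eq_label_cons, h]
  obtain ⟨y, hy⟩ := a.2.2.2.1
  obtain ⟨y', hy'⟩ := a'.2.2.2.1
  rw [hy, hy'] at hw
  obtain rfl : u = u' := Subtype.ext (List.append_inj_left' hw rfl)
  congr 1
  exact Subtype.ext (by rw [eq_label_cons, eq_label_cons, h])

/-- There is an arrow with label `x` and target `v` if `x v` is legal. -/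
theorem exists_arrow {x : G} {v : UfVertex F} (h : Legal F (x :: v.1)) :
    ∃ (u : UfVertex F) (a : u ⟶ v), label a = x := by
  have hne : x :: v.1 ≠ [] := List.cons_ne_nil _ _
  -- The arrow is the word `x v` itself, so its source must be `x v` without the last letter; for `ℓ
  -- = 0` this is the empty word.
  let u : UfVertex F := ⟨(x :: v.1).dropLast, by simp [v.2.1],
    h.of_infix (List.dropLast_prefix _).isInfix⟩
  let a : u ⟶ v := ⟨x :: v.1, by simp [v.2.1], h,
    ⟨(x :: v.1).getLast hne, (List.dropLast_append_getLast hne).symm⟩, x, rfl⟩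
  exact ⟨u, a, label_eq_of_cons a rfl⟩

/-- A path starts at the initial segment of its word. -/
theorem prefix_of_path {u v : UfVertex F} (p : Quiver.Path u v) : u.1 <+: pathLabel p ++ v.1 := by
  induction p with
  | nil => exact List.prefix_rfl
  | @cons v w p a ih =>
    rw [pathLabel, List.append_assoc, List.singleton_append, ← eq_label_cons]
    obtain ⟨y, hy⟩ := a.2.2.2.1
    -- Composing with an arrow out of the old target only appends the letter `y` to the word
    -- consisting of label and target.
    rw [hy, ← List.append_assoc]
    exact ih.trans (List.prefix_append _ _)

/-- Both `u` and `v` are the prefix of length `ℓ` of the word `pathLabel p` followed by `w`. This is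
what gives `e_v f(v) = f(v)` and `e_u f(v) = 0` for `u ≠ v`. -/
theorem eq_of_pathLabel {u v w : UfVertex F} (p : Quiver.Path u w) (h : pathLabel p = v.1) :
    u = v := by
  refine Subtype.ext (List.IsPrefix.eq_of_length ?_ (u.2.1.trans v.2.1.symm))
  rw [← h]
  refine List.prefix_of_prefix_length_le (prefix_of_path p) (List.prefix_append _ _) ?_
  rw [h, u.2.1, v.2.1]

variable [Fintype G]

/-- Since label and target determine an arrow, exactly one summand of `arrowSum` can be composed
with `q`. -/
theorem arrowSum_mul_of_label {u v w : UfVertex F} (a : u ⟶ v) (q : Quiver.Path v w) :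
    arrowSum k F (label a) * PathAlgebra.ofPath k ⟨v, w, q⟩ =
      PathAlgebra.ofPath k ⟨u, w, a.toPath.comp q⟩ := by
  classical
  simp only [arrowSum, Finset.sum_mul]
  rw [Finset.sum_eq_single u, Finset.sum_eq_single v, Finset.sum_eq_single a]
  · rw [if_pos rfl, PathAlgebra.ofPath_mul_ofPath, PathAlgebra.pathMul_comp]
  · intro a' _ ha'
    rw [if_neg, zero_mul]
    intro h
    exact ha' (eq_of_heq (Sigma.mk.inj (arrow_ext a' a h)).2)
  · simp
  · intro v' _ hv'
    refine Finset.sum_eq_zero fun a' _ => ?_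
    split_ifs
    · rw [PathAlgebra.ofPath_mul_ofPath, PathAlgebra.pathMul_of_ne _ _ hv']
    · rw [zero_mul]
  · simp
  · intro u' _ hu'
    refine Finset.sum_eq_zero fun v' _ => Finset.sum_eq_zero fun a' _ => ?_
    split_ifs with h
    · rw [PathAlgebra.ofPath_mul_ofPath]
      by_cases hv' : v' = v
      · subst hv'
        exact absurd (Sigma.mk.inj (arrow_ext a' a h)).1 hu'
      · rw [PathAlgebra.pathMul_of_ne _ _ hv']
    · rw [zero_mul]
  · simp

theorem arrowSum_mul_of_not_legal {x : G} {v w : UfVertex F} (h : ¬ Legal F (x :: v.1))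
    (q : Quiver.Path v w) : arrowSum k F x * PathAlgebra.ofPath k ⟨v, w, q⟩ = 0 := by
  classical
  simp only [arrowSum, Finset.sum_mul]
  refine Finset.sum_eq_zero fun u' _ => Finset.sum_eq_zero fun v' _ =>
    Finset.sum_eq_zero fun a' _ => ?_
  split_ifs with hx
  · rw [PathAlgebra.ofPath_mul_ofPath]
    by_cases hv' : v' = v
    · subst hv'
      refine absurd ?_ h
      rw [← hx, ← eq_label_cons]
      exact a'.2.2.1
    · rw [PathAlgebra.pathMul_of_ne _ _ hv']
  · rw [zero_mul]

variable (k) in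
/-- The trivial path at `v`. -/
abbrev idem (v : UfVertex F) : PathAlgebra k (UfVertex F) :=
  PathAlgebra.ofPath k ⟨v, v, Quiver.Path.nil⟩

theorem ofPath_mul_idem {u v : UfVertex F} (p : Quiver.Path u v) :
    PathAlgebra.ofPath k ⟨u, v, p⟩ * idem k v = PathAlgebra.ofPath k ⟨u, v, p⟩ := by
  rw [PathAlgebra.ofPath_mul_ofPath, PathAlgebra.pathMul_comp, Quiver.Path.comp_nil]

/-- A path is determined by its label and its target. -/
theorem ufHom_pathLabel_mul_idem {u v : UfVertex F} (p : Quiver.Path u v) :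
    ufHom k F (MonomialAlgebra.monomial k F (pathLabel p)) * idem k v =
      PathAlgebra.ofPath k ⟨u, v, p⟩ := by
  induction p with
  | nil => rw [pathLabel, MonomialAlgebra.monomial_nil, map_one, one_mul]
  | @cons v w p a ih =>
    rw [pathLabel, MonomialAlgebra.monomial_append, map_mul, ufHom_generator, mul_assoc,
      arrowSum_mul_of_label, Quiver.Path.comp_nil]
    -- Inserting the trivial path at `v` makes the induction hypothesis for `p` applicable.
    have h : PathAlgebra.ofPath k ⟨v, w, a.toPath⟩ =
        idem k v * PathAlgebra.ofPath k ⟨v, w, a.toPath⟩ := by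
      rw [PathAlgebra.ofPath_mul_ofPath, PathAlgebra.pathMul_comp, Quiver.Path.nil_comp]
    rw [h, ← mul_assoc, ih, PathAlgebra.ofPath_mul_ofPath, PathAlgebra.pathMul_comp]
    rfl

theorem idem_mul_ufHom_of_ne {u v : UfVertex F} (h : u ≠ v) :
    idem k u * ufHom k F (MonomialAlgebra.monomial k F v.1) = 0 := by
  rw [ufHom_monomial]
  refine (Submodule.span_le (p := LinearMap.ker (LinearMap.mulLeft k (idem k u)))).2 ?_
    (lift_freeWord_mem v.1)
  rintro _ ⟨⟨a, b, p⟩, hp, rfl⟩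
  rw [SetLike.mem_coe, LinearMap.mem_ker, LinearMap.mulLeft_apply, PathAlgebra.ofPath_mul_ofPath,
    PathAlgebra.pathMul_of_ne]
  rw [eq_of_pathLabel p hp]
  exact h

theorem idem_mul_ufHom (v : UfVertex F) :
    idem k v * ufHom k F (MonomialAlgebra.monomial k F v.1) =
      ufHom k F (MonomialAlgebra.monomial k F v.1) := by
  conv_rhs => rw [← one_mul (ufHom k F _), PathAlgebra.one_def, Finset.sum_mul]
  rw [Finset.sum_eq_single v (fun u _ hu => idem_mul_ufHom_of_ne hu) (by simp)]

open Classical in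
variable (k) in
/-- The homomorphism of left `A`-modules `kQ → A` that sends a path with label `w` and target `v`
to `w v`, and paths with other targets to `0`. -/
def retraction (v : UfVertex F) : PathAlgebra k (UfVertex F) →ₗ[k] MonomialAlgebra k F :=
  PathAlgebra.lift fun p =>
    if p.2.1 = v then MonomialAlgebra.monomial k F (pathLabel p.2.2 ++ v.1) else 0

theorem retraction_ofPath {u v : UfVertex F} (p : Quiver.Path u v) :
    retraction k v (PathAlgebra.ofPath k ⟨u, v, p⟩) =
      MonomialAlgebra.monomial k F (pathLabel p ++ v.1) := by
  rw [retraction, PathAlgebra.lift_ofPath, if_pos rfl]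

theorem retraction_ofPath_of_ne {u v w : UfVertex F} (p : Quiver.Path u w) (h : w ≠ v) :
    retraction k v (PathAlgebra.ofPath k ⟨u, w, p⟩) = 0 := by
  rw [retraction, PathAlgebra.lift_ofPath, if_neg h]

/-- Let `p` be a path with source `u`, label `w` and target `v`. If `x u` is legal, `f(x) p` is the
path extended by one arrow, with label `x w`. If not, `f(x) p = 0`, and `x w v` vanishes in `A` as
well, since `u` is a prefix of `w v`. -/
theorem retraction_arrowSum_mul (v : UfVertex F) (x : G) (b : PathAlgebra k (UfVertex F)) :
    retraction k v (arrowSum k F x * b) =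
      MonomialAlgebra.monomial k F [x] * retraction k v b := by
  induction b using PathAlgebra.induction with
  | zero => simp
  | add b c hb hc => rw [mul_add, map_add, hb, hc, map_add, mul_add]
  | smul r p =>
    rw [mul_smul_comm, map_smul, map_smul, mul_smul_comm]
    congr 1
    obtain ⟨u, w, p⟩ := p
    by_cases hl : Legal F (x :: u.1)
    · obtain ⟨t, a, rfl⟩ := exists_arrow hl
      rw [arrowSum_mul_of_label]
      by_cases hw : w = v
      · subst hw
        rw [retraction_ofPath, retraction_ofPath, pathLabel_comp, List.append_assoc,
          MonomialAlgebra.monomial_append]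
        rfl
      · rw [retraction_ofPath_of_ne _ hw, retraction_ofPath_of_ne _ hw, mul_zero]
    · rw [arrowSum_mul_of_not_legal hl, map_zero]
      by_cases hw : w = v
      · subst hw
        rw [retraction_ofPath, ← MonomialAlgebra.monomial_append,
          MonomialAlgebra.monomial_eq_zero_of_not_legal]
        refine fun h => hl (h.of_infix (List.IsPrefix.isInfix ?_))
        exact (List.prefix_cons_inj x).2 (prefix_of_path p)
      · rw [retraction_ofPath_of_ne _ hw, mul_zero]

theorem retraction_mul (v : UfVertex F) (a : MonomialAlgebra k F)
    (b : PathAlgebra k (UfVertex F)) :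
    retraction k v (ufHom k F a * b) = a * retraction k v b := by
  have ha : a ∈ Submodule.span k (Set.range (MonomialAlgebra.monomial k F)) := by
    rw [MonomialAlgebra.span_monomial]
    trivial
  induction ha using Submodule.span_induction generalizing b with
  | zero => simp
  | add x y _ _ hx hy => rw [map_add, add_mul, map_add, hx, hy, add_mul]
  | smul r x _ hx => rw [map_smul, smul_mul_assoc, map_smul, hx, smul_mul_assoc]
  | mem a ha =>
    obtain ⟨w, rfl⟩ := ha
    induction w with
    | nil => rw [MonomialAlgebra.monomial_nil, map_one, one_mul, one_mul]
    | cons x w ih =>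
      rw [← List.singleton_append, MonomialAlgebra.monomial_append, map_mul (ufHom k F),
        ufHom_generator, mul_assoc, retraction_arrowSum_mul, ih, mul_assoc]

theorem retraction_one (v : UfVertex F) :
    retraction k v 1 = MonomialAlgebra.monomial k F v.1 := by
  rw [PathAlgebra.one_def, map_sum, Finset.sum_eq_single v
    (fun u _ hu => retraction_ofPath_of_ne _ hu) (by simp), retraction_ofPath]
  rfl

/-- Write a path as `f(label) e_w` with `w` its target. Then `e_w f(v)` is `f(v)` for `w = v`, which
leaves `f(label) f(v)`, and `0` otherwise. -/
theorem ufHom_retraction (v : UfVertex F) (b : PathAlgebra k (UfVertex F)) :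
    ufHom k F (retraction k v b) = b * ufHom k F (MonomialAlgebra.monomial k F v.1) := by
  induction b using PathAlgebra.induction with
  | zero => simp
  | add b c hb hc => rw [map_add, map_add, hb, hc, add_mul]
  | smul r p =>
    rw [map_smul, map_smul, smul_mul_assoc]
    congr 1
    obtain ⟨u, w, p⟩ := p
    by_cases hw : w = v
    · subst hw
      rw [retraction_ofPath, MonomialAlgebra.monomial_append, map_mul,
        ← ufHom_pathLabel_mul_idem p, mul_assoc, idem_mul_ufHom]
    · rw [retraction_ofPath_of_ne _ hw, map_zero, ← ofPath_mul_idem p, mul_assoc,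
        idem_mul_ufHom_of_ne hw, mul_zero]

/-- Every path is `f(label) e_v` for its target `v`, so the trivial paths generate `kQ` as a left
`A`-module. -/
theorem span_idem : ⨆ v : UfVertex F,
    LinearMap.range (LinearMap.mulRight k (idem k v) ∘ₗ (ufHom k F).toLinearMap) = ⊤ := by
  refine eq_top_iff.2 fun b _ => ?_
  induction b using PathAlgebra.induction with
  | zero => exact zero_mem _
  | add b c hb hc => exact add_mem (hb trivial) (hc trivial)
  | smul r p =>
    obtain ⟨u, v, p⟩ := p
    refine Submodule.smul_mem _ r (Submodule.mem_iSup_of_mem v ⟨_, ufHom_pathLabel_mul_idem p⟩)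

variable (k F) in
/-- The cofinite retraction of `f : A → kQ` given by the legal words of length `ℓ`. -/
def cofiniteRetraction : CofiniteRetraction (ufHom k F) where
  ι := UfVertex F
  gen v := MonomialAlgebra.monomial k F v.1
  residue := Submodule.span k (MonomialAlgebra.monomial k F '' {w | w.length < ell F})
  finite_residue := FiniteDimensional.span_of_finite k ((List.finite_length_lt G _).image _)
  residue_sup := MonomialAlgebra.span_sup_eq_top k F (ell F)
  θ := retraction k
  θ_mul := retraction_mul
  θ_one := retraction_one
  map_θ := ufHom_retraction
  κ := UfVertex F
  e := idem k
  span_e := span_idem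

end UfVertex

end Ufnarovskii

end

/-- Let `k` be a field, `G` a finite set of letters `x` with degrees `d x ≥ 1`, `F` a finite set of
words, `A = k⟨G⟩/(F)`, and `Q = Q(A)` the weighted Ufnarovskii graph. Then `- ⊗_A kQ` induces an
equivalence `QGr A ≌ QGr kQ`, and this equivalence commutes with the shift functors. -/
theorem theorem4p3 {k G : Type u} [Field k] [Fintype G] (d : G → ℕ) (hd : ∀ x, 1 ≤ d x)
    (F : Finset (List G)) :
    ∃ E : QGr (MonomialAlgebra.grading k F d) ≌
        QGr (PathAlgebra.grading k (UfVertex.arrowDegree F d)),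
      Nonempty (QGr.proj (MonomialAlgebra.grading k F d) ⋙ E.functor ≅
        tensorFunctor (UfVertex.ufHom k F) (UfVertex.ufHom_mem d) ⋙
          QGr.proj (PathAlgebra.grading k (UfVertex.arrowDegree F d))) ∧
      Nonempty (QGr.shift (MonomialAlgebra.grading k F d) ⋙ E.functor ≅
        E.functor ⋙ QGr.shift (PathAlgebra.grading k (UfVertex.arrowDegree F d))) := by
  exact (UfVertex.cofiniteRetraction k F).exists_equivalence (UfVertex.ufHom_mem d)
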